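/- Let $r\ge 0$, let $\mathbf F_r$ be the free group on $x_1,\dots,x_r$, let $w\in\mathbf F_r$, and let $m\in\mathbb Z_{\ge 2}$ or $m=\infty$. For $N\ge 0$ let $S^1\wr S_N\le \mathrm{GL}_N(\mathbb C)$ be the group of all matrices with exactly one nonzero entry in every row and every column, all nonzero entries having absolute value $1$, and for $m\in\mathbb Z_{\ge2}$ let $C_m\wr S_N$ be its subgroup of those matrices all of whose nonzero entries are $m$-th roots of unity. Put $G(N)=C_m\wr S_N$ if $m\in\mathbb Z_{\ge2}$ and $G(N)=S^1\wr S_N$ if $m=\infty$. Let $A_1,\dots,A_r$ be independent Haar-distributed random elements of the compact group $G(N)$ (uniformly distributed if $m<\infty$), and put $$\mathcal{T}r_w(G(N))=\mathbb E\big[\mathrm{tr}\; w(A_1,\dots,A_r)\big].$$ For a free group $H$, let $\mathrm{rank}(H)\in\mathbb Z_{\ge0}\cup\{\infty\}$ be the cardinality of a basis. For $m\in\mathbb Z_{\ge2}$ let $K_m(H)$ be the kernel of the homomorphism $H\to (\mathbb Z/m\mathbb Z)^{\mathrm{rank}(H)}$ (direct sum) sending the elements of a basis to the distinct standard generators (this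 kernel does not depend on the basis), and let $K_\infty(H)=[H,H]$. Define $$\chi_m(w)=1-\min\{\mathrm{rank}(H) : H\le \mathbf F_r,\ w\in K_m(H)\},$$ with $\chi_m(w)=-\infty$ if there is no such $H$. Then the set of subgroups $H\le\mathbf F_r$ with $w\in K_m(H)$ and $1-\mathrm{rank}(H)=\chi_m(w)$ is finite, and, if $C$ denotes its cardinality, $$\mathcal{T}r_w(G(N))=C\cdot N^{\chi_m(w)}+O\big(N^{\chi_m(w)-1}\big)\qquad (N\to\infty),$$ where $r$, $w$ and $m$ are fixed and $N^{-\infty}=0$. In particular, if $\chi_m(w)=-\infty$, then $\mathcal{T}r_w(G(N))=0$ for all $N$. -/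

import Mathlib

open MeasureTheory Filter Asymptotics
open scoped MatrixGroups

/-! ### Generalized symmetric groups as groups of complex matrices -/

/-- `A` has exactly one nonzero entry in every row and in every column, and all its nonzero
entries have absolute value `1`. -/
def IsCircleMonomial {N : ℕ} (A : Matrix (Fin N) (Fin N) ℂ) : Prop :=
  (∀ i, ∃! j, A i j ≠ 0) ∧ (∀ j, ∃! i, A i j ≠ 0) ∧ ∀ i j, A i j ≠ 0 → ‖A i j‖ = 1

/-- The matrix with entry `z i` at the place `(i, σ i)` and zeros elsewhere. -/
def monomialMatrix {N : ℕ} (σ : Equiv.Perm (Fin N)) (z : Fin N → Circle) :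
    Matrix (Fin N) (Fin N) ℂ :=
  Matrix.of fun i j => if σ i = j then (z i : ℂ) else 0

lemma isCircleMonomial_iff {N : ℕ} (A : Matrix (Fin N) (Fin N) ℂ) :
    IsCircleMonomial A ↔ ∃ σ z, A = monomialMatrix σ z := by
  constructor
  · rintro ⟨hr, hc, hn⟩
    choose s hs hs' using hr
    choose t ht ht' using hc
    let σ : Equiv.Perm (Fin N) :=
      ⟨s, t, fun i => (ht' _ _ (hs i)).symm, fun j => (hs' _ _ (ht j)).symm⟩
    refine ⟨σ, fun i => ⟨A i (s i), by simpa [Submonoid.unitSphere] using hn _ _ (hs i)⟩, ?_⟩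
    ext i j
    by_cases h : s i = j
    · subst h
      simp [monomialMatrix, σ]
    · have : A i j = 0 := by
        by_contra h0
        exact h (hs' i j h0).symm
      simp [monomialMatrix, σ, h, this]
  · rintro ⟨σ, z, rfl⟩
    refine ⟨fun i => ⟨σ i, by simp [monomialMatrix], fun j hj => ?_⟩,
      fun j => ⟨σ.symm j, by simp [monomialMatrix], fun i hi => ?_⟩, fun i j h => ?_⟩
    · by_contra h
      exact hj (by simp [monomialMatrix, Ne.symm h])
    · by_contra h
      refine hi ?_
      have : σ i ≠ j := fun e => h (by simp [← e])
      simp [monomialMatrix, this]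
    · by_cases e : σ i = j
      · simpa [monomialMatrix, e] using Circle.norm_coe (z i)
      · exact absurd (by simp [monomialMatrix, e]) h

lemma monomialMatrix_mul {N : ℕ} (σ τ : Equiv.Perm (Fin N)) (z y : Fin N → Circle) :
    monomialMatrix σ z * monomialMatrix τ y
      = monomialMatrix (τ * σ) (fun i => z i * y (σ i)) := by
  ext i k
  rw [Matrix.mul_apply, Finset.sum_eq_single (σ i)]
  · by_cases e : τ (σ i) = k <;> simp [monomialMatrix, e]
  · intro j _ hj
    simp [monomialMatrix, hj.symm]
  · simp

lemma monomialMatrix_one {N : ℕ} :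
    monomialMatrix (1 : Equiv.Perm (Fin N)) (fun _ => 1) = 1 := by
  ext i k
  by_cases e : i = k <;> simp [monomialMatrix, Matrix.one_apply, e]

/-- `monomialMatrix σ z` as an invertible matrix. -/
noncomputable def monomialUnit {N : ℕ} (σ : Equiv.Perm (Fin N)) (z : Fin N → Circle) : GL (Fin N) ℂ where
  val := monomialMatrix σ z
  inv := monomialMatrix σ⁻¹ (fun i => (z (σ⁻¹ i))⁻¹)
  val_inv := by
    rw [monomialMatrix_mul, ← monomialMatrix_one]
    simp
  inv_val := by
    rw [monomialMatrix_mul, ← monomialMatrix_one]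
    simp

lemma isCircleMonomial_coe_iff {N : ℕ} (A : GL (Fin N) ℂ) :
    IsCircleMonomial (A : Matrix (Fin N) (Fin N) ℂ) ↔ ∃ σ z, A = monomialUnit σ z := by
  rw [isCircleMonomial_iff]
  refine exists_congr fun σ => exists_congr fun z => ?_
  exact ⟨fun h => Units.ext h, fun h => by rw [h]; rfl⟩

lemma monomialUnit_mul {N : ℕ} (σ τ : Equiv.Perm (Fin N)) (z y : Fin N → Circle) :
    monomialUnit σ z * monomialUnit τ y = monomialUnit (τ * σ) (fun i => z i * y (σ i)) :=
  Units.ext (monomialMatrix_mul σ τ z y)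

lemma monomialUnit_inv {N : ℕ} (σ : Equiv.Perm (Fin N)) (z : Fin N → Circle) :
    (monomialUnit σ z)⁻¹ = monomialUnit σ⁻¹ (fun i => (z (σ⁻¹ i))⁻¹) :=
  Units.ext rfl

/-- The wreath product `S¹ ≀ S_N`: the subgroup of `GL_N(ℂ)` of all matrices with exactly one
nonzero entry in every row and column, all nonzero entries having absolute value `1`. -/
noncomputable def circleWreath (N : ℕ) : Subgroup (GL (Fin N) ℂ) where
  carrier := {A | IsCircleMonomial (A : Matrix (Fin N) (Fin N) ℂ)}
  mul_mem' := by
    intro A B hA hB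
    obtain ⟨σ, z, rfl⟩ := (isCircleMonomial_coe_iff A).1 hA
    obtain ⟨τ, y, rfl⟩ := (isCircleMonomial_coe_iff B).1 hB
    exact (isCircleMonomial_coe_iff _).2 ⟨_, _, monomialUnit_mul σ τ z y⟩
  one_mem' := (isCircleMonomial_iff _).2 ⟨1, fun _ => 1, monomialMatrix_one.symm⟩
  inv_mem' := by
    intro A hA
    obtain ⟨σ, z, rfl⟩ := (isCircleMonomial_coe_iff A).1 hA
    exact (isCircleMonomial_coe_iff _).2 ⟨_, _, monomialUnit_inv σ z⟩

lemma monomialMatrix_pow_iff {N : ℕ} (m : ℕ) (σ : Equiv.Perm (Fin N)) (z : Fin N → Circle) :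
    (∀ i j, monomialMatrix σ z i j ≠ 0 → monomialMatrix σ z i j ^ m = 1) ↔ ∀ i, z i ^ m = 1 := by
  constructor
  · intro h i
    have := h i (σ i) (by simp [monomialMatrix])
    simp only [monomialMatrix, Matrix.of_apply, if_true] at this
    exact Circle.ext (by simpa using this)
  · intro h i j hij
    by_cases e : σ i = j
    · have := congrArg (fun x : Circle => (x : ℂ)) (h i)
      simpa [monomialMatrix, e] using this
    · exact absurd (by simp [monomialMatrix, e]) hij

/-- The wreath product `C_m ≀ S_N`: the subgroup of `S¹ ≀ S_N` of those matrices all of whose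
nonzero entries are `m`-th roots of unity. -/
noncomputable def cyclicWreath (m N : ℕ) : Subgroup (GL (Fin N) ℂ) where
  carrier := {A | A ∈ circleWreath N ∧
    ∀ i j, (A : Matrix (Fin N) (Fin N) ℂ) i j ≠ 0 → (A : Matrix (Fin N) (Fin N) ℂ) i j ^ m = 1}
  mul_mem' := by
    rintro A B ⟨hA, hA'⟩ ⟨hB, hB'⟩
    refine ⟨mul_mem hA hB, ?_⟩
    obtain ⟨σ, z, rfl⟩ := (isCircleMonomial_coe_iff A).1 hA
    obtain ⟨τ, y, rfl⟩ := (isCircleMonomial_coe_iff B).1 hB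
    have hA'' := (monomialMatrix_pow_iff m σ z).1 hA'
    have hB'' := (monomialMatrix_pow_iff m τ y).1 hB'
    rw [monomialUnit_mul]
    exact (monomialMatrix_pow_iff m _ _).2 fun i => by rw [mul_pow, hA'', hB'', one_mul]
  one_mem' := by
    refine ⟨one_mem _, fun i j h => ?_⟩
    by_cases e : i = j
    · simp [e]
    · exact absurd (by simp [e]) h
  inv_mem' := by
    rintro A ⟨hA, hA'⟩
    refine ⟨inv_mem hA, ?_⟩
    obtain ⟨σ, z, rfl⟩ := (isCircleMonomial_coe_iff A).1 hA
    have hA'' := (monomialMatrix_pow_iff m σ z).1 hA'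
    rw [monomialUnit_inv]
    exact (monomialMatrix_pow_iff m _ _).2 fun i => by rw [inv_pow, hA'', inv_one]

/-- For `m ∈ ℕ ∪ {∞}`: the group `C_m ≀ S_N` if `m` is finite, and `S¹ ≀ S_N` if `m = ∞`. -/
noncomputable def genSymGroup (m : ℕ∞) (N : ℕ) : Subgroup (GL (Fin N) ℂ) :=
  match m with
  | ⊤ => circleWreath N
  | (k : ℕ) => cyclicWreath k N

lemma isCompact_circleWreath (N : ℕ) : IsCompact (circleWreath N : Set (GL (Fin N) ℂ)) := by
  have hset : (circleWreath N : Set (GL (Fin N) ℂ)) =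
      ⋃ σ : Equiv.Perm (Fin N), Set.range (monomialUnit σ) := by
    ext A
    simp only [Set.mem_iUnion, Set.mem_range]
    refine (isCircleMonomial_coe_iff A).trans ?_
    exact exists_congr fun σ => exists_congr fun z => eq_comm
  rw [hset]
  refine isCompact_iUnion fun σ => isCompact_range ?_
  have key : ∀ (τ : Equiv.Perm (Fin N)),
      Continuous (fun z : Fin N → Circle => monomialMatrix τ z) := by
    intro τ
    refine continuous_matrix fun i j => ?_
    by_cases e : τ i = j
    · simp only [monomialMatrix, Matrix.of_apply, e, if_true]
      fun_prop
    · simp only [monomialMatrix, Matrix.of_apply, e, if_false]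
      fun_prop
  refine Units.continuous_iff.2 ⟨key σ, ?_⟩
  exact (key σ⁻¹).comp (by fun_prop : Continuous fun (z : Fin N → Circle) i => (z (σ⁻¹ i))⁻¹)

lemma isCompact_cyclicWreath (m N : ℕ) :
    IsCompact (cyclicWreath m N : Set (GL (Fin N) ℂ)) := by
  have hset : (cyclicWreath m N : Set (GL (Fin N) ℂ)) = (circleWreath N : Set (GL (Fin N) ℂ)) ∩
      ⋂ (i : Fin N) (j : Fin N), ({A | (A : Matrix (Fin N) (Fin N) ℂ) i j = 0} ∪
        {A | (A : Matrix (Fin N) (Fin N) ℂ) i j ^ m = 1}) := by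
    ext A
    simp only [Set.mem_inter_iff, Set.mem_iInter, Set.mem_union, Set.mem_ofPred_eq]
    exact and_congr Iff.rfl (forall_congr' fun i => forall_congr' fun j => or_iff_not_imp_left.symm)
  rw [hset]
  refine (isCompact_circleWreath N).inter_right ?_
  refine isClosed_iInter fun i => isClosed_iInter fun j => ?_
  have hc : Continuous fun A : GL (Fin N) ℂ => (A : Matrix (Fin N) (Fin N) ℂ) i j :=
    (Units.continuous_val (M := Matrix (Fin N) (Fin N) ℂ)).matrix_elem i j
  exact (isClosed_eq hc continuous_const).union (isClosed_eq (hc.pow m) continuous_const)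

instance (m : ℕ∞) (N : ℕ) : CompactSpace (genSymGroup m N) := by
  refine isCompact_iff_compactSpace.1 ?_
  match m with
  | ⊤ => exact isCompact_circleWreath N
  | (k : ℕ) => exact isCompact_cyclicWreath k N

noncomputable instance (m : ℕ∞) (N : ℕ) : MeasurableSpace (genSymGroup m N) := borel _

instance (m : ℕ∞) (N : ℕ) : BorelSpace (genSymGroup m N) := ⟨rfl⟩

/-! ### Word measures -/

/-- The Haar probability measure of the compact group `genSymGroup m N`, i.e. the Haar measure
which gives total mass `1` to the whole group (the uniform measure if `m` is finite). -/
noncomputable def haarProb (m : ℕ∞) (N : ℕ) : Measure (genSymGroup m N) :=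
  Measure.haarMeasure ⊤

instance (m : ℕ∞) (N : ℕ) : IsProbabilityMeasure (haarProb m N) :=
  ⟨by simpa [haarProb] using
    Measure.haarMeasure_self (K₀ := (⊤ : TopologicalSpace.PositiveCompacts (genSymGroup m N)))⟩

/-- The expected trace of a `w`-random element of `G = genSymGroup m N`: substitute the `r`
generators of the free group by independent Haar random elements `A 0, …, A (r - 1)` of `G`,
evaluate `w`, and take the expectation of the trace of the resulting matrix. -/
noncomputable def expectedTrace {r : ℕ} (w : FreeGroup (Fin r)) (m : ℕ∞) (N : ℕ) : ℂ :=
  ∫ A : Fin r → genSymGroup m N,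
    (((FreeGroup.lift A w : genSymGroup m N) : GL (Fin N) ℂ) : Matrix (Fin N) (Fin N) ℂ).trace
    ∂(Measure.pi fun _ => haarProb m N)

/-! ### The subgroups `K_m` and the exponent `χ_m` -/

/-- The rank of a free group: the cardinality of a basis (`⊤` if it is infinite). -/
noncomputable def freeGroupRank (F : Type*) [Group F] [IsFreeGroup F] : ℕ∞ :=
  ENat.card (IsFreeGroup.Generators F)

/-- For a free group `F` with a basis, the homomorphism from `F` to the direct sum of copies of
`C_k = ℤ/kℤ` indexed by the basis, which maps every basis element to the corresponding standard
generator. -/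
noncomputable def modAbelianization (k : ℕ) (F : Type*) [Group F] [IsFreeGroup F] :
    F →* Multiplicative (IsFreeGroup.Generators F →₀ ZMod k) :=
  IsFreeGroup.lift fun x => Multiplicative.ofAdd (Finsupp.single x 1)

/-- The subgroup `K_m(F)` of a free group `F`: the kernel of `F → C_m ^ rank F` if `m` is finite,
and the commutator subgroup `[F, F]` if `m = ∞`. -/
noncomputable def KSubgroup (m : ℕ∞) (F : Type*) [Group F] [IsFreeGroup F] : Subgroup F :=
  match m with
  | ⊤ => commutator F
  | (k : ℕ) => (modAbelianization k F).ker

/-- The relation `w ∈ K_m(H)` for a subgroup `H` of the free group containing `w`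
(subgroups of free groups are free by the Nielsen-Schreier theorem). -/
def MemK {r : ℕ} (m : ℕ∞) (w : FreeGroup (Fin r)) (H : Subgroup (FreeGroup (Fin r))) : Prop :=
  ∃ h : w ∈ H, (⟨w, h⟩ : H) ∈ KSubgroup m H

/-- The Euler characteristic `1 - n` of a free group of rank `n`, with value `-∞` (that is, `⊥`)
if `n` is infinite. -/
def oneSub (n : ℕ∞) : WithBot ℤ :=
  match n with
  | ⊤ => ⊥
  | (k : ℕ) => ((1 - (k : ℤ) : ℤ) : WithBot ℤ)

/-- `χ_m(w) = 1 - min {rank H | w ∈ K_m(H)}`, which is `-∞` (that is, `⊥`) if there is no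
subgroup `H` with `w ∈ K_m(H)`: the infimum of the empty set in `ℕ∞` is `⊤`. -/
noncomputable def chi {r : ℕ} (m : ℕ∞) (w : FreeGroup (Fin r)) : WithBot ℤ :=
  oneSub (sInf {n : ℕ∞ | ∃ H : Subgroup (FreeGroup (Fin r)), MemK m w H ∧ freeGroupRank H = n})

/-- The subgroups `H` with `w ∈ K_m(H)` and `χ_m(w) = 1 - rank H`. -/
def criticalSubgroups {r : ℕ} (m : ℕ∞) (w : FreeGroup (Fin r)) :
    Set (Subgroup (FreeGroup (Fin r))) :=
  {H | MemK m w H ∧ chi m w = oneSub (freeGroupRank H)}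

/-- `N ^ e` for an exponent `e ∈ ℤ ∪ {-∞}`, where `N ^ (-∞) = 0`. -/
noncomputable def powBot (N : ℕ) (e : WithBot ℤ) : ℂ :=
  match e with
  | ⊥ => 0
  | (k : ℤ) => (N : ℂ) ^ k

/-! ### Subgroups of free groups generated along a set of suffixes -/

section Core

variable {ι X : Type*}

/-! A tuple in `G(N)^r` consists of permutations `σ` and phases. The phases define a cocycle over
the action of the free group on `Fin N`. Hence the `j`-th diagonal entry of `w(A)` vanishes unless
`w` fixes `j`, and otherwise is the value at `w` of a homomorphism from the stabilizer of `j` to the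
phase group. If `w` lies in `K_m` of the stabilizer, this value is always 1. If not, some
homomorphism is nontrivial at `w`, and translating by the corresponding diagonal matrices shows that
the average is 0. So `(N!)^r` times the expected trace counts the pairs `(σ, j)` with `w` in `K_m`
of the stabilizer of `j` (`expectedTrace_eq_card`).

Let `S` be the finite set of suffixes of `w`. The pairs are sorted by the core `K` of the
stabilizer, generated by the loops at `j` that become visible while `S` acts on `j`: the fundamental
group of the graph traced out. Homomorphisms on the core extend to the stabilizer
(`exists_extend_coreSubgroup`), so `w ∈ K_m` depends on `K` only, and finitely many `K` occur. If
the graph has `V` vertices and `e_i` edges labelled `i`, there are `N(N-1)⋯(N-V+1) ∏ (N-e_i)!` pairs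
with core `K` (`card_marked_actions`), while `rank K = ∑ e_i - V + 1`
(`freeGroupRank_coreSubgroup`). Thus `K` contributes `N^(1 - rank K) (1 + O(1/N))`.

The leading term counts the cores of minimal rank. These are exactly the critical subgroups: passing
to the core preserves `w ∈ K_m` and does not increase the rank, and equality of ranks forces a
subgroup to be its own core (`coreSubgroup_eq_of_freeGroupRank_eq`), a Hopfian argument based on
residual finiteness. Ranks of cores are found by counting homomorphisms to finite groups, not by
constructing bases. -/

/-- The stabilizer of `x` under the action of a group `F` by permutations of `X`. -/
abbrev pointStab {F : Type*} [Group F] (a : F →* Equiv.Perm X) (x : X) : Subgroup F :=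
  (MulAction.stabilizer (Equiv.Perm X) x).comap a

lemma mem_pointStab {F : Type*} [Group F] {a : F →* Equiv.Perm X} {x : X} {g : F} :
    g ∈ pointStab a x ↔ a g x = x := by
  simp [MulAction.mem_stabilizer_iff]

/-- Turns generators of a core into coincidences along the trajectory of `x`. -/
lemma inv_mul_mem_pointStab {F : Type*} [Group F] {a : F →* Equiv.Perm X} {x : X} {g h : F} :
    g⁻¹ * h ∈ pointStab a x ↔ a g x = a h x := by
  rw [mem_pointStab, map_mul, map_inv, Equiv.Perm.mul_apply, Equiv.Perm.inv_eq_iff_eq, eq_comm]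

/-- The subgroup of `H` generated by those quotients `s⁻¹ * t` of elements of `S` which belong
to `H`. -/
def coreSubgroup {F : Type*} [Group F] (S : Set F) (H : Subgroup F) : Subgroup F :=
  Subgroup.closure {g | g ∈ H ∧ ∃ s ∈ S, ∃ t ∈ S, g = s⁻¹ * t}

section

variable {F : Type*} [Group F] {S : Set F} {H K : Subgroup F}

lemma coreSubgroup_le : coreSubgroup S H ≤ H :=
  (Subgroup.closure_le _).2 fun _ h => h.1

lemma inv_mul_mem_coreSubgroup {s t : F} (hs : s ∈ S) (ht : t ∈ S) :
    s⁻¹ * t ∈ coreSubgroup S H ↔ s⁻¹ * t ∈ H :=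
  ⟨fun h => coreSubgroup_le h, fun h => Subgroup.subset_closure ⟨h, s, hs, t, ht, rfl⟩⟩

lemma coreSubgroup_congr
    (h : ∀ s ∈ S, ∀ t ∈ S, s⁻¹ * t ∈ H ↔ s⁻¹ * t ∈ K) : coreSubgroup S H = coreSubgroup S K := by
  unfold coreSubgroup
  congr 1
  ext g
  constructor
  · rintro ⟨hg, s, hs, t, ht, rfl⟩
    exact ⟨(h s hs t ht).1 hg, s, hs, t, ht, rfl⟩
  · rintro ⟨hg, s, hs, t, ht, rfl⟩
    exact ⟨(h s hs t ht).2 hg, s, hs, t, ht, rfl⟩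

lemma coreSubgroup_idem : coreSubgroup S (coreSubgroup S H) = coreSubgroup S H :=
  coreSubgroup_congr fun _ hs _ ht => inv_mul_mem_coreSubgroup hs ht

/-- Having a prescribed core is a pattern of coincidences between elements of `S`; this is the form
in which pairs `(σ, j)` are counted later. -/
lemma coreSubgroup_eq_iff (hK : coreSubgroup S K = K) :
    coreSubgroup S H = K ↔ ∀ s ∈ S, ∀ t ∈ S, s⁻¹ * t ∈ H ↔ s⁻¹ * t ∈ K := by
  constructor
  · rintro rfl s hs t ht
    exact (inv_mul_mem_coreSubgroup hs ht).symm
  · intro h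
    rw [coreSubgroup_congr h, hK]

lemma mem_coreSubgroup_iff {w : F} (h1 : 1 ∈ S) (hw : w ∈ S) :
    w ∈ coreSubgroup S H ↔ w ∈ H := by
  simpa using inv_mul_mem_coreSubgroup (H := H) h1 hw

/-- A core is generated by a subset of the finite set of quotients `s⁻¹ * t`. -/
lemma finite_range_coreSubgroup (hS : S.Finite) :
    (Set.range fun H : Subgroup F => coreSubgroup S H).Finite := by
  have hT : (Set.image2 (fun s t => s⁻¹ * t) S S).Finite := hS.image2 _ hS
  refine (hT.finite_subsets.image Subgroup.closure).subset ?_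
  rintro _ ⟨H, rfl⟩
  refine ⟨_, ?_, rfl⟩
  rintro _ ⟨_, s, hs, t, ht, rfl⟩
  exact ⟨s, hs, t, ht, rfl⟩

end

/-! ### Connected sets and suffixes of a word -/

/-- `S` contains `1`, and all elements of `S` can be reached from `1` by steps within `S` which
are left multiplications by generators or their inverses. -/
def StepConnected (S : Set (FreeGroup ι)) : Prop :=
  1 ∈ S ∧ ∀ p : FreeGroup ι → Prop, p 1 →
    (∀ i, ∀ s ∈ S, FreeGroup.of i * s ∈ S → (p s ↔ p (FreeGroup.of i * s))) → ∀ s ∈ S, p s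

/-- The set of all suffixes of the word `L`, as elements of the free group. -/
def suffixSet (L : List (ι × Bool)) : Set (FreeGroup ι) :=
  {g | ∃ l, l <:+ L ∧ FreeGroup.mk l = g}

lemma finite_suffixSet (L : List (ι × Bool)) : (suffixSet L).Finite := by
  have : (suffixSet L) ⊆ FreeGroup.mk '' {l | l ∈ L.tails} := by
    rintro _ ⟨l, hl, rfl⟩
    exact ⟨l, by simpa using hl, rfl⟩
  exact ((List.finite_toSet _).image _).subset this

lemma mk_mem_suffixSet (L : List (ι × Bool)) : FreeGroup.mk L ∈ suffixSet L :=
  ⟨L, List.suffix_rfl, rfl⟩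

/-- Deleting the first letter of a suffix is a step within the set. An inverse letter gives a step
in the opposite direction, which is why steps in `StepConnected` carry an equivalence. -/
lemma stepConnected_suffixSet (L : List (ι × Bool)) : StepConnected (suffixSet L) := by
  refine ⟨⟨[], List.nil_suffix, rfl⟩, fun p h1 hp => ?_⟩
  rintro _ ⟨l, hl, rfl⟩
  induction l with
  | nil => exact h1
  | cons x l ih =>
    have hl' : l <:+ L := (List.suffix_cons x l).trans hl
    have hx : FreeGroup.mk (x :: l) ∈ suffixSet L := ⟨_, hl, rfl⟩
    have hy : FreeGroup.mk l ∈ suffixSet L := ⟨_, hl', rfl⟩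
    have ih := ih hl'
    have hmul : FreeGroup.mk (x :: l) = FreeGroup.mk [x] * FreeGroup.mk l := by
      rw [FreeGroup.mul_mk]; rfl
    obtain ⟨i, b⟩ := x
    cases b
    · have e : FreeGroup.of i * FreeGroup.mk ((i, false) :: l) = FreeGroup.mk l := by
        rw [hmul, ← mul_assoc]
        have : FreeGroup.mk [(i, false)] = (FreeGroup.of i)⁻¹ := rfl
        rw [this, mul_inv_cancel, one_mul]
      exact (hp i _ hx (by rwa [e])).2 (by rwa [e])
    · have e : FreeGroup.of i * FreeGroup.mk l = FreeGroup.mk ((i, true) :: l) := hmul.symm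
      rw [← e]
      exact (hp i _ hy (by rwa [e])).1 ih

end Core

/-! ### Cocycles -/

section Cocycle

variable {ι X G : Type*} [Group G]

/-- The cocycle identity for a function `c` with respect to an action by permutations. -/
def IsPermCocycle {F : Type*} [Group F] (a : F →* Equiv.Perm X) (c : F → X → G) : Prop :=
  ∀ u v x, c (u * v) x = c u (a v x) * c v x

namespace IsPermCocycle

variable {F : Type*} [Group F] {a : F →* Equiv.Perm X} {c : F → X → G}

lemma one (hc : IsPermCocycle a c) (x : X) : c 1 x = 1 := by
  simpa using hc 1 1 x

lemma inv_apply (hc : IsPermCocycle a c) (u : F) (x : X) : c u⁻¹ (a u x) = (c u x)⁻¹ := by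
  have := hc u⁻¹ u x
  rw [inv_mul_cancel, hc.one] at this
  exact eq_inv_of_mul_eq_one_left this.symm

lemma inv_mul_apply (hc : IsPermCocycle a c) {u v : F} {x : X} (h : a u x = a v x) :
    c (u⁻¹ * v) x = (c u x)⁻¹ * c v x := by
  rw [hc, ← h, hc.inv_apply]

/-- A cocycle restricts to a homomorphism on every point stabilizer. -/
def monodromy (hc : IsPermCocycle a c) (x : X) : pointStab a x →* G where
  toFun h := c h x
  map_one' := hc.one x
  map_mul' u v := by
    have := mem_pointStab.1 v.2
    simp [hc u v x, this]

@[simp]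
lemma monodromy_apply (hc : IsPermCocycle a c) (x : X) (h : pointStab a x) :
    hc.monodromy x h = c h x := rfl

end IsPermCocycle

/-- Skew product: let the generators permute `X × G`, with the labels acting by left multiplication
on the fibre. The cocycle is the second coordinate of the image of `(x, 1)`. -/
lemma exists_isPermCocycle (a : FreeGroup ι →* Equiv.Perm X) (l : ι → X → G) :
    ∃ c : FreeGroup ι → X → G, IsPermCocycle a c ∧ ∀ i x, c (FreeGroup.of i) x = l i x := by
  let e : ι → Equiv.Perm (X × G) := fun i =>
    { toFun := fun p => (a (FreeGroup.of i) p.1, l i p.1 * p.2)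
      invFun := fun p => ((a (FreeGroup.of i))⁻¹ p.1,
        (l i ((a (FreeGroup.of i))⁻¹ p.1))⁻¹ * p.2)
      left_inv := fun p => by simp
      right_inv := fun p => by simp }
  let E := FreeGroup.lift e
  -- The skew product commutes with right multiplication on the fibre.
  have key : ∀ u x g, E u (x, g) = (a u x, (E u (x, 1)).2 * g) := by
    intro u
    induction u using FreeGroup.induction_on with
    | C1 => simp
    | of i => intro x g; simp [E, e]
    | inv_of i h => intro x g; simp [E, e, Equiv.Perm.inv_def]
    | mul u v hu hv =>
      intro x g
      rw [map_mul, Equiv.Perm.mul_apply, hv, hu, Equiv.Perm.mul_apply, hv x 1,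
        hu _ ((E v (x, 1)).2 * 1)]
      simp [mul_assoc]
  refine ⟨fun u x => (E u (x, 1)).2, fun u v x => ?_, fun i x => by simp [E, e]⟩
  simp only [map_mul, Equiv.Perm.mul_apply]
  rw [key v x 1, key u]

lemma IsPermCocycle.ext_of {a : FreeGroup ι →* Equiv.Perm X} {c d : FreeGroup ι → X → G}
    (hc : IsPermCocycle a c) (hd : IsPermCocycle a d)
    (h : ∀ i x, c (FreeGroup.of i) x = d (FreeGroup.of i) x) (u : FreeGroup ι) (x : X) :
    c u x = d u x := by
  induction u using FreeGroup.induction_on generalizing x with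
  | C1 => rw [hc.one, hd.one]
  | of i => exact h i x
  | inv_of i _ =>
    obtain ⟨y, rfl⟩ := (a (FreeGroup.of i)).surjective x
    rw [hc.inv_apply, hd.inv_apply, h]
  | mul u v hu hv => rw [hc, hd, hu, hv]

/-! ### The graph traced out by `S` -/

/-- The points visited when the elements of `S` act on `x`. -/
def visited {F : Type*} [Group F] (S : Set F) (a : F →* Equiv.Perm X) (x : X) : Set X :=
  {v | ∃ s ∈ S, a s x = v}

/-- The points from which a step in direction `i` is made when the elements of `S` act on `x`. -/
def steps (S : Set (FreeGroup ι)) (a : FreeGroup ι →* Equiv.Perm X) (x : X) (i : ι) : Set X :=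
  {v | ∃ s ∈ S, FreeGroup.of i * s ∈ S ∧ a s x = v}

lemma steps_subset_visited (S : Set (FreeGroup ι)) (a : FreeGroup ι →* Equiv.Perm X) (x : X)
    (i : ι) : steps S a x i ⊆ visited S a x :=
  fun _ ⟨s, hs, _, h⟩ => ⟨s, hs, h⟩

lemma apply_mem_visited_of_mem_steps {S : Set (FreeGroup ι)} {a : FreeGroup ι →* Equiv.Perm X}
    {x : X} {i : ι} {v : X} (hv : v ∈ steps S a x i) : a (FreeGroup.of i) v ∈ visited S a x := by
  obtain ⟨s, hs, hs', rfl⟩ := hv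
  exact ⟨_, hs', by simp⟩

/-- A section of the map `s ↦ a s x` from `S` to the visited points. -/
lemma exists_section {F : Type*} [Group F] {S : Set F} (h1 : 1 ∈ S) (a : F →* Equiv.Perm X)
    (x : X) : ∃ t : X → F, t x = 1 ∧ ∀ v ∈ visited S a x, t v ∈ S ∧ a (t v) x = v := by
  classical
  choose! t ht ht' using fun (v : X) (hv : v ∈ visited S a x) => hv
  refine ⟨fun v => if v = x then 1 else t v, by simp, fun v hv => ?_⟩
  by_cases h : v = x
  · subst h; simp [h1]
  · simp [h, ht v hv, ht' v hv]

variable {S : Set (FreeGroup ι)} {a : FreeGroup ι →* Equiv.Perm X} {x : X}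

/-- These are the Schreier generators for the section `t`. Each splits at `s` into two quotients of
elements of `S` that fix `x`. -/
lemma section_step_mem {t : X → FreeGroup ι}
    (ht : ∀ v ∈ visited S a x, t v ∈ S ∧ a (t v) x = v) {i : ι} {v : X}
    (hv : v ∈ steps S a x i) :
    (t (a (FreeGroup.of i) v))⁻¹ * FreeGroup.of i * t v ∈ coreSubgroup S (pointStab a x) := by
  have hv1 := steps_subset_visited _ _ _ _ hv
  have hv2 := apply_mem_visited_of_mem_steps hv
  obtain ⟨s, hs, hs', h⟩ := hv
  have e : (t (a (FreeGroup.of i) v))⁻¹ * FreeGroup.of i * t v =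
      ((t (a (FreeGroup.of i) v))⁻¹ * (FreeGroup.of i * s)) * (s⁻¹ * t v) := by group
  rw [e]
  refine mul_mem ?_ ?_
  · rw [inv_mul_mem_coreSubgroup (ht _ hv2).1 hs', inv_mul_mem_pointStab, (ht _ hv2).2, map_mul,
      Equiv.Perm.mul_apply, h]
  · rw [inv_mul_mem_coreSubgroup hs (ht _ hv1).1, inv_mul_mem_pointStab, (ht _ hv1).2, h]

/-- Every homomorphism on the core subgroup is the monodromy of a cocycle which is trivial outside
the visited steps, with prescribed values along a section. -/
lemma exists_cocycle_extending (hS : StepConnected S) {t : X → FreeGroup ι} (htx : t x = 1)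
    (ht : ∀ v ∈ visited S a x, t v ∈ S ∧ a (t v) x = v)
    (φ : coreSubgroup S (pointStab a x) →* G) (g : X → G) (hg : g x = 1) :
    ∃ c : FreeGroup ι → X → G, IsPermCocycle a c ∧
      (∀ i, ∀ v ∉ steps S a x i, c (FreeGroup.of i) v = 1) ∧
      (∀ v ∈ visited S a x, c (t v) x = g v) ∧
      ∀ h : coreSubgroup S (pointStab a x), c h x = φ h := by
  classical
  -- Extension of `φ` by 1, which avoids carrying membership proofs; it is multiplicative on the
  -- core only.
  let ψ : FreeGroup ι → G := fun u => if h : u ∈ coreSubgroup S (pointStab a x) then φ ⟨u, h⟩ else 1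
  have ψmul : ∀ u v, u ∈ coreSubgroup S (pointStab a x) → v ∈ coreSubgroup S (pointStab a x) → ψ (u * v) = ψ u * ψ v := by
    intro u v hu hv
    simp only [ψ, hu, hv, mul_mem hu hv, dif_pos]
    exact φ.map_mul ⟨u, hu⟩ ⟨v, hv⟩
  have ψinv : ∀ u, u ∈ coreSubgroup S (pointStab a x) → ψ u⁻¹ = (ψ u)⁻¹ := by
    intro u hu
    simp only [ψ, hu, inv_mem hu, dif_pos]
    exact φ.map_inv ⟨u, hu⟩
  have ψone : ψ 1 = 1 := by
    simp only [ψ, one_mem, dif_pos]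
    exact φ.map_one
  -- Label each edge by `φ` of its Schreier generator, twisted by the gauge `g` at both ends so that
  -- `t v` receives the value `g v`.
  obtain ⟨c, hc, hcl⟩ := exists_isPermCocycle a (fun i v => if v ∈ steps S a x i then
    g (a (FreeGroup.of i) v) * ψ ((t (a (FreeGroup.of i) v))⁻¹ * FreeGroup.of i * t v) * (g v)⁻¹
    else 1)
  have tmem : ∀ s ∈ S, (t (a s x))⁻¹ * s ∈ coreSubgroup S (pointStab a x) := by
    intro s hs
    have := ht (a s x) ⟨s, hs, rfl⟩
    rw [inv_mul_mem_coreSubgroup this.1 hs, inv_mul_mem_pointStab, this.2]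
  have key : ∀ s ∈ S, c s x = g (a s x) * ψ ((t (a s x))⁻¹ * s) := by
    refine hS.2 _ ?_ ?_
    · simp [hc.one, hg, htx, ψone]
    · intro i s hs hs'
      have hst : a s x ∈ steps S a x i := ⟨s, hs, hs', rfl⟩
      have e1 : c (FreeGroup.of i * s) x = g (a (FreeGroup.of i * s) x) *
          ψ ((t (a (FreeGroup.of i * s) x))⁻¹ * (FreeGroup.of i * s)) *
          (g (a s x) * ψ ((t (a s x))⁻¹ * s))⁻¹ * c s x := by
        rw [hc, hcl, if_pos hst]
        have e2 : (t (a (FreeGroup.of i * s) x))⁻¹ * (FreeGroup.of i * s) =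
          ((t (a (FreeGroup.of i) (a s x)))⁻¹ * FreeGroup.of i * t (a s x)) *
            ((t (a s x))⁻¹ * s) := by
          rw [map_mul, Equiv.Perm.mul_apply]; group
        rw [e2, ψmul _ _ (section_step_mem ht hst) (tmem s hs), map_mul, Equiv.Perm.mul_apply]
        group
      rw [e1]
      constructor
      · intro h; rw [h]; group
      · intro h
        rw [mul_assoc, mul_eq_left, inv_mul_eq_one] at h
        exact h.symm
  refine ⟨c, hc, fun i v hv => by simp [hcl, hv], fun v hv => ?_, fun h => ?_⟩
  · obtain ⟨h1, h2⟩ := ht v hv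
    rw [key _ h1, h2, inv_mul_cancel, ψone, mul_one]
  · have hle : coreSubgroup S (pointStab a x) ≤ pointStab a x := coreSubgroup_le
    have : ∀ u (hu : u ∈ coreSubgroup S (pointStab a x)), c u x = ψ u := by
      intro u hu
      induction hu using Subgroup.closure_induction with
      | mem u hu =>
        obtain ⟨hu, s, hs, t', ht', rfl⟩ := hu
        rw [inv_mul_mem_pointStab] at hu
        have e : s⁻¹ * t' = ((t (a s x))⁻¹ * s)⁻¹ * ((t (a t' x))⁻¹ * t') := by
          rw [hu]; group
        rw [hc.inv_mul_apply hu, key s hs, key t' ht', e, ψmul _ _ (inv_mem (tmem s hs))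
          (tmem t' ht'), ψinv _ (tmem s hs), hu]
        group
      | one => rw [hc.one, ψone]
      | mul u v hu hv h1 h2 =>
        rw [hc, mem_pointStab.1 (hle hv), h1, h2, ψmul u v hu hv]
      | inv u hu h1 =>
        have : c u⁻¹ x = (c u x)⁻¹ := by
          rw [← hc.inv_apply, mem_pointStab.1 (hle hu)]
        rw [this, h1, ψinv u hu]
    rw [this h h.2]
    simp [ψ]

end Cocycle

/-! ### Residual finiteness of free groups -/

/-- For two injections into a finite type there is a permutation which maps the first one to the
second one. -/
lemma exists_perm_extending {V W : Type*} [Finite W] (f g : V → W) (hf : f.Injective)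
    (hg : g.Injective) : ∃ σ : Equiv.Perm W, ∀ v, σ (f v) = g v := by
  classical
  have := Fintype.ofFinite W
  let e : {w // w ∈ Set.range f} ≃ {w // w ∈ Set.range g} :=
    (Equiv.ofInjective f hf).symm.trans (Equiv.ofInjective g hg)
  refine ⟨e.extendSubtype, fun v => ?_⟩
  rw [Equiv.extendSubtype_apply_of_mem e (f v) ⟨v, rfl⟩]
  have : (⟨f v, ⟨v, rfl⟩⟩ : {w // w ∈ Set.range f}) = Equiv.ofInjective f hf v := rfl
  have h2 : e ⟨f v, ⟨v, rfl⟩⟩ = Equiv.ofInjective g hg v := by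
    rw [this, Equiv.trans_apply, Equiv.symm_apply_apply]
  rw [h2]
  rfl

/-- On the suffixes of `u`, left multiplication by a generator is a partial injection; complete it
to a permutation. The trajectory of 1 under `u` then ends at `u`, which differs from 1. -/
lemma exists_finite_action_of_ne_one {ι : Type} (u : FreeGroup ι) (hu : u ≠ 1) :
    ∃ (W : Type) (_ : Finite W) (f : FreeGroup ι →* Equiv.Perm W), f u ≠ 1 := by
  classical
  let S := suffixSet u.toWord
  have hS : StepConnected S := stepConnected_suffixSet _
  have : Finite S := finite_suffixSet _
  have huS : u ∈ S := by
    have := mk_mem_suffixSet u.toWord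
    rwa [FreeGroup.mk_toWord] at this
  have : ∀ i : ι, ∃ σ : Equiv.Perm S, ∀ v : {s : S // FreeGroup.of i * s.1 ∈ S},
      σ v.1 = ⟨FreeGroup.of i * v.1.1, v.2⟩ := fun i =>
    exists_perm_extending (fun v : {s : S // FreeGroup.of i * s.1 ∈ S} => v.1)
      (fun v => ⟨FreeGroup.of i * v.1.1, v.2⟩) Subtype.val_injective fun v w h => by
        simpa [Subtype.ext_iff] using h
  choose σ hσ using this
  refine ⟨S, inferInstance, FreeGroup.lift σ, fun h => hu ?_⟩
  have key : ∀ s ∈ S, ((FreeGroup.lift σ s ⟨1, hS.1⟩ : S) : FreeGroup ι) = s := by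
    refine hS.2 _ (by simp) fun i s hs hs' => ?_
    have e := hσ i ⟨⟨s, hs⟩, hs'⟩
    rw [map_mul, Equiv.Perm.mul_apply, FreeGroup.lift_apply_of]
    constructor
    · intro h
      have h' : FreeGroup.lift σ s ⟨1, hS.1⟩ = ⟨s, hs⟩ := Subtype.ext h
      rw [h', e]
    · intro h
      have h' : σ i (FreeGroup.lift σ s ⟨1, hS.1⟩) = σ i ⟨s, hs⟩ := (Subtype.ext h).trans e.symm
      rw [(σ i).injective h']
  have := key u huS
  rw [h] at this
  simpa using this.symm

/-! ### Ranks and homomorphisms to finite groups -/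

section

variable {ι : Type*} {S : Set (FreeGroup ι)}

lemma steps_finite {X : Type*} (hfin : S.Finite) (a : FreeGroup ι →* Equiv.Perm X) (x : X)
    (i : ι) : (steps S a x i).Finite :=
  (hfin.image fun s => a s x).subset fun _ ⟨s, hs, _, h⟩ => ⟨s, hs, h⟩

lemma visited_finite {X : Type*} (hfin : S.Finite) (a : FreeGroup ι →* Equiv.Perm X) (x : X) :
    (visited S a x).Finite :=
  (hfin.image fun s => a s x).subset fun _ ⟨s, hs, h⟩ => ⟨s, hs, h⟩

end

section Rank

/-- For a finite group with at least two elements, this count determines a finite rank. -/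
lemma natCard_monoidHom {H : Type*} [Group H] [IsFreeGroup H] {n : ℕ}
    (hn : freeGroupRank H = n) (G : Type*) [Group G] :
    Nat.card (H →* G) = Nat.card G ^ n := by
  have : Finite (IsFreeGroup.Generators H) := by
    rw [← ENat.card_lt_top, ← freeGroupRank, hn]
    exact ENat.natCast_lt_top n
  rw [← Nat.card_congr (IsFreeGroup.lift (G := H) (H := G)), Nat.card_fun]
  congr 1
  have : (Nat.card (IsFreeGroup.Generators H) : ℕ∞) = n := by
    rw [← hn, freeGroupRank, ENat.card_eq_coe_natCard]
  exact_mod_cast this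

lemma infinite_monoidHom {H : Type*} [Group H] [IsFreeGroup H]
    (hn : freeGroupRank H = ⊤) (G : Type*) [Group G] [Nontrivial G] :
    Infinite (H →* G) := by
  have : Infinite (IsFreeGroup.Generators H) := by
    rwa [freeGroupRank, ENat.card_eq_top] at hn
  exact (Equiv.infinite_iff (IsFreeGroup.lift (G := H) (H := G))).1 inferInstance

/-- Every subgroup is a point stabilizer, so results on `pointStab` apply to all subgroups. -/
lemma exists_action {F : Type*} [Group F] (H : Subgroup F) :
    pointStab (MulAction.toPermHom F (F ⧸ H)) ((1 : F) : F ⧸ H) = H := by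
  ext g
  rw [mem_pointStab]
  simp [MulAction.Quotient.smul_mk, QuotientGroup.eq]

variable {ι : Type} {S : Set (FreeGroup ι)} {H : Subgroup (FreeGroup ι)}

/-- The algebraic content of the core being a free factor: the extension is the monodromy of a
cocycle trivial off the traced graph. With the identity as `φ` it gives a retraction onto the core.
-/
lemma exists_extend_coreSubgroup {G : Type*} [Group G] (hS : StepConnected S)
    (φ : coreSubgroup S H →* G) :
    ∃ ψ : H →* G, ∀ h (hh : h ∈ coreSubgroup S H), ψ ⟨h, coreSubgroup_le hh⟩ = φ ⟨h, hh⟩ := by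
  obtain ⟨X, a, x, rfl⟩ : ∃ (X : Type) (a : FreeGroup ι →* Equiv.Perm X) (x : X),
      pointStab a x = H := ⟨_, _, _, exists_action H⟩
  obtain ⟨t, ht1, ht⟩ := exists_section hS.1 a x
  obtain ⟨c, hc, -, -, h⟩ := exists_cocycle_extending hS ht1 ht φ (fun _ => 1) rfl
  exact ⟨hc.monodromy x, fun u hu => h ⟨u, hu⟩⟩

/-- Labellings of the steps correspond to pairs consisting of a homomorphism on the core subgroup
and a labelling of the visited points. -/
lemma card_labellings {X : Type*} {G : Type} [Group G] 
    (hS : StepConnected S) (a : FreeGroup ι →* Equiv.Perm X) (x : X) :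
    Nat.card (((Σ i, steps S a x i) → G) × G) =
      Nat.card ((coreSubgroup S (pointStab a x) →* G) × (visited S a x → G)) := by
  classical
  obtain ⟨t, ht1, ht⟩ := exists_section hS.1 a x
  have hx : x ∈ visited S a x := ⟨1, hS.1, by simp⟩
  choose c hc hcl using fun l : (Σ i, steps S a x i) → G =>
    exists_isPermCocycle a (fun i v => if h : v ∈ steps S a x i then l ⟨i, v, h⟩ else 1)
  let φ : ((Σ i, steps S a x i) → G) → (coreSubgroup S (pointStab a x) →* G) := fun l =>
    ((hc l).monodromy x).comp (Subgroup.inclusion coreSubgroup_le)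
  have hφ : ∀ l h, φ l h = c l h x := fun l h => rfl
  -- The extra factor `G` is the value at the base point, where `t x = 1` makes the cocycle trivial.
  refine Nat.card_congr (Equiv.ofBijective
    (fun p => (φ p.1, fun v => c p.1 (t v) x * p.2)) ⟨?_, ?_⟩)
  · rintro ⟨l, b⟩ ⟨l', b'⟩ h
    obtain ⟨h1, h2⟩ := Prod.ext_iff.1 h
    have hb : b = b' := by
      have := congrFun h2 ⟨x, hx⟩
      simpa [ht1, (hc _).one] using this
    subst hb
    have h2 : ∀ v ∈ visited S a x, c l (t v) x = c l' (t v) x := fun v hv => by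
      simpa using congrFun h2 ⟨v, hv⟩
    refine Prod.ext (funext ?_) rfl
    rintro ⟨i, v, hv⟩
    have hv1 := steps_subset_visited _ _ _ _ hv
    have hv2 := apply_mem_visited_of_mem_steps hv
    -- An edge label is recovered from the monodromy of its Schreier generator and the values at its
    -- two ends.
    have key : ∀ l, l ⟨i, v, hv⟩ = c l (t (a (FreeGroup.of i) v)) x *
        φ l ⟨_, section_step_mem ht hv⟩ * (c l (t v) x)⁻¹ := by
      intro l
      have e1 : c l (FreeGroup.of i) v = l ⟨i, v, hv⟩ := by rw [hcl, dif_pos hv]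
      have e2 : a (t (a (FreeGroup.of i) v)) x = a (FreeGroup.of i * t v) x := by
        rw [(ht _ hv2).2, map_mul, Equiv.Perm.mul_apply, (ht _ hv1).2]
      rw [hφ]
      change _ = _ * c l ((t (a (FreeGroup.of i) v))⁻¹ * FreeGroup.of i * t v) x * _
      rw [mul_assoc _ (FreeGroup.of i), (hc l).inv_mul_apply e2, hc l (FreeGroup.of i),
        (ht _ hv1).2, e1]
      group
    change l ⟨i, v, hv⟩ = l' ⟨i, v, hv⟩
    rw [key l, key l', h2 _ hv1, h2 _ hv2, (show φ l = φ l' from h1)]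
  · rintro ⟨ψ, g⟩
    obtain ⟨d, hd, hd1, hd2, hd3⟩ := exists_cocycle_extending hS ht1 ht ψ
      (fun v => if h : v ∈ visited S a x then g ⟨v, h⟩ * (g ⟨x, hx⟩)⁻¹ else 1) (by simp [hx])
    have hcd : ∀ u y, c (fun p => d (FreeGroup.of p.1) p.2) u y = d u y := by
      refine (hc _).ext_of hd fun i y => ?_
      rw [hcl]
      by_cases h : y ∈ steps S a x i
      · rw [dif_pos h]
      · rw [dif_neg h, hd1 i y h]
    refine ⟨(fun p => d (FreeGroup.of p.1) p.2, g ⟨x, hx⟩), Prod.ext ?_ (funext ?_)⟩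
    · ext h
      simp only [hφ, hcd, hd3]
    · rintro ⟨v, hv⟩
      simp only [hcd, hd2 v hv, dif_pos hv]
      group

/-- The Euler characteristic formula, read off by comparing exponents of 2 in `card_labellings` for
the group of order 2. -/
lemma freeGroupRank_coreSubgroup {X : Type*} [Fintype ι]
    (hS : StepConnected S) (hfin : S.Finite) (a : FreeGroup ι →* Equiv.Perm X) (x : X) :
    ∃ n : ℕ, freeGroupRank (coreSubgroup S (pointStab a x)) = n ∧
      n + (visited S a x).ncard = ∑ i, (steps S a x i).ncard + 1 := by
  have : Finite (visited S a x) := visited_finite hfin a x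
  have : ∀ i, Finite (steps S a x i) := steps_finite hfin a x
  have key := card_labellings (G := Multiplicative (ZMod 2)) hS a x
  rw [Nat.card_prod, Nat.card_prod, Nat.card_fun, Nat.card_fun] at key
  have h2 : Nat.card (Multiplicative (ZMod 2)) = 2 := by simp
  rw [h2, Nat.card_sigma] at key
  rcases hr : freeGroupRank (coreSubgroup S (pointStab a x)) with _ | n
  -- Infinite rank would make the right side 0, as `Nat.card` is 0 on infinite types, while the left
  -- side is a power of 2.
  · have := infinite_monoidHom hr (Multiplicative (ZMod 2))
    rw [Nat.card_eq_zero_of_infinite, zero_mul] at key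
    simp at key
  · refine ⟨n, rfl, ?_⟩
    rw [natCard_monoidHom hr, h2, ← pow_succ, ← pow_add] at key
    exact (Nat.pow_right_injective le_rfl key).symm

lemma exists_freeGroupRank_coreSubgroup [Finite ι]
    (hS : StepConnected S) (hfin : S.Finite) (H : Subgroup (FreeGroup ι)) :
    ∃ n : ℕ, freeGroupRank (coreSubgroup S H) = n := by
  have := Fintype.ofFinite ι
  obtain ⟨n, hn, -⟩ := freeGroupRank_coreSubgroup hS hfin
    (MulAction.toPermHom (FreeGroup ι) (FreeGroup ι ⧸ H)) ((1 : FreeGroup ι) : FreeGroup ι ⧸ H)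
  rw [exists_action] at hn
  exact ⟨n, hn⟩

lemma restrict_coreSubgroup_surjective (hS : StepConnected S) (G : Type*) [Group G] :
    Function.Surjective fun φ : H →* G =>
      φ.comp (Subgroup.inclusion (coreSubgroup_le (S := S) (H := H))) := by
  intro φ
  obtain ⟨ψ, h⟩ := exists_extend_coreSubgroup hS φ
  exact ⟨ψ, MonoidHom.ext fun u => h u u.2⟩

lemma freeGroupRank_coreSubgroup_le [Finite ι] (hS : StepConnected S) (hfin : S.Finite) :
    freeGroupRank (coreSubgroup S H) ≤ freeGroupRank H := by
  obtain ⟨n, hn⟩ := exists_freeGroupRank_coreSubgroup hS hfin H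
  rw [hn]
  rcases hr : freeGroupRank H with _ | k
  · exact le_top
  · have h1 := natCard_monoidHom hn (Multiplicative (ZMod 2))
    have h2 := natCard_monoidHom hr (Multiplicative (ZMod 2))
    have h3 : Nat.card (Multiplicative (ZMod 2)) = 2 := by simp
    rw [h3] at h1 h2
    have : Finite (H →* Multiplicative (ZMod 2)) := Nat.finite_of_card_ne_zero (by simp [h2])
    have h := Nat.card_le_card_of_surjective _
      (restrict_coreSubgroup_surjective (H := H) hS (Multiplicative (ZMod 2)))
    rw [h1, h2, Nat.pow_le_pow_iff_right (by norm_num)] at h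
    exact Nat.cast_le.2 h

/-- Let `ρ` retract `H` onto its core. If `u ∈ H` is not in the core, some finite action `f`
separates `ρ u` from `u`. Equal ranks make restriction of homomorphisms to the core bijective for
finite targets, so `f ∘ ρ` and `f`, which agree on the core, agree on `H`: a contradiction. -/
lemma coreSubgroup_eq_of_freeGroupRank_eq [Finite ι] (hS : StepConnected S) (hfin : S.Finite)
    (h : freeGroupRank (coreSubgroup S H) = freeGroupRank H) : coreSubgroup S H = H := by
  obtain ⟨n, hn⟩ := exists_freeGroupRank_coreSubgroup hS hfin H
  have hn' := hn
  rw [h] at hn'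
  refine le_antisymm coreSubgroup_le fun u hu => ?_
  obtain ⟨ρ, hρ⟩ := exists_extend_coreSubgroup hS (MonoidHom.id (coreSubgroup S H))
  by_contra hu'
  have hne : (ρ ⟨u, hu⟩ : FreeGroup ι)⁻¹ * u ≠ 1 := by
    intro e
    rw [inv_mul_eq_one] at e
    exact hu' (e ▸ (ρ ⟨u, hu⟩).2)
  obtain ⟨W, hW, f, hf⟩ := exists_finite_action_of_ne_one _ hne
  have hG := Finite.of_injective (fun σ : Equiv.Perm W => (σ : W → W)) DFunLike.coe_injective
  have hpos : Nat.card (Equiv.Perm W) ≠ 0 := Nat.card_pos.ne'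
  have h1 := natCard_monoidHom hn (Equiv.Perm W)
  have h2 := natCard_monoidHom hn' (Equiv.Perm W)
  have : Finite (H →* Equiv.Perm W) := Nat.finite_of_card_ne_zero (by simp [h2, hpos])
  have hbij := (Nat.bijective_iff_surjective_and_card _).2
    ⟨restrict_coreSubgroup_surjective (H := H) hS (Equiv.Perm W), h2.trans h1.symm⟩
  have e : (f.comp (coreSubgroup S H).subtype).comp ρ = f.comp H.subtype := by
    refine hbij.1 (MonoidHom.ext fun v => ?_)
    have := hρ v v.2
    simp only [MonoidHom.coe_comp, Function.comp_apply]
    change f (ρ ⟨v, _⟩) = f v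
    rw [this]
    rfl
  have e' : f (ρ ⟨u, hu⟩) = f u := DFunLike.congr_fun e ⟨u, hu⟩
  exact hf (by rw [map_mul, map_inv, e', inv_mul_cancel])

end Rank

/-! ### The relation `MemK` in terms of homomorphisms -/

section MemK

/-- As `ZMod 0` is `ℤ`, the abelianization map factors through the free abelian group on the basis.
-/
lemma modAbelianization_zero_ker (H : Type*) [Group H] [IsFreeGroup H] :
    (modAbelianization 0 H).ker ≤ commutator H := by
  intro u hu
  let θ : Multiplicative (IsFreeGroup.Generators H →₀ ZMod 0) →* Abelianization H :=
    AddMonoidHom.toMultiplicativeLeft (Finsupp.liftAddHom fun x =>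
      zmultiplesHom (Additive (Abelianization H))
        (Additive.ofMul (Abelianization.of (IsFreeGroup.of x))))
  have e : θ.comp (modAbelianization 0 H) = Abelianization.of := by
    refine IsFreeGroup.ext_hom fun x => ?_
    rw [MonoidHom.comp_apply, modAbelianization, IsFreeGroup.lift_of]
    have : (1 : ZMod 0) = (1 : ℤ) := rfl
    simp only [θ, this]
    change Additive.toMul ((Finsupp.liftAddHom _) (Finsupp.single x (1 : ℤ))) = _
    erw [Finsupp.liftAddHom_apply_single]
    simp
    rfl
  have h1 : Abelianization.of u = 1 := by
    rw [← e, MonoidHom.comp_apply, MonoidHom.mem_ker.1 hu, map_one]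
  rwa [← MonoidHom.mem_ker, Abelianization.ker_of] at h1

/-- The quotient by `K_m` is universal among homomorphisms to abelian groups killed by `m` (all
abelian groups if `m = ∞`). -/
lemma map_eq_one_of_mem_KSubgroup {H : Type*} [Group H] [IsFreeGroup H] {m : ℕ∞} {u : H}
    (hu : u ∈ KSubgroup m H) {B : Type*} [CommGroup B] (hB : ∀ k : ℕ, m = k → ∀ b : B, b ^ k = 1)
    (φ : H →* B) : φ u = 1 := by
  rcases m with _ | k
  · exact Abelianization.commutator_subset_ker φ hu
  · have hB' : ∀ b : B, b ^ k = 1 := hB k rfl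
    let θ : Multiplicative (IsFreeGroup.Generators H →₀ ZMod k) →* B :=
      AddMonoidHom.toMultiplicativeLeft (Finsupp.liftAddHom fun x =>
        ZMod.lift k ⟨zmultiplesHom (Additive B) (Additive.ofMul (φ (IsFreeGroup.of x))), by
          simp [← ofMul_pow, hB']⟩)
    have e : θ.comp (modAbelianization k H) = φ := by
      refine IsFreeGroup.ext_hom fun x => ?_
      rw [MonoidHom.comp_apply, modAbelianization, IsFreeGroup.lift_of]
      change Additive.toMul ((Finsupp.liftAddHom _) (Finsupp.single x 1)) = _
      rw [Finsupp.liftAddHom_apply_single]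
      have : (1 : ZMod k) = ((1 : ℤ) : ZMod k) := by simp
      rw [this, ZMod.lift_coe]
      simp
    rw [← e, MonoidHom.comp_apply, MonoidHom.mem_ker.1 (show u ∈ (modAbelianization k H).ker from hu),
      map_one]

/-- Coordinates of `modAbelianization` are such homomorphisms. Since `⊤.toNat = 0`, the target is
`ℤ` when `m = ∞`, so one statement covers both cases. -/
lemma mem_KSubgroup_of_forall_hom {H : Type*} [Group H] [IsFreeGroup H] {m : ℕ∞} {u : H}
    (hu : ∀ φ : H →* Multiplicative (ZMod m.toNat), φ u = 1) : u ∈ KSubgroup m H := by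
  have key : u ∈ (modAbelianization m.toNat H).ker := by
    rw [MonoidHom.mem_ker]
    refine Multiplicative.toAdd.injective (Finsupp.ext fun x => ?_)
    have := hu ((AddMonoidHom.toMultiplicative (Finsupp.applyAddHom x)).comp
      (modAbelianization m.toNat H))
    exact congrArg Multiplicative.toAdd this
  rcases m with _ | k
  · exact modAbelianization_zero_ker H key
  · exact key

lemma Multiplicative.zmod_pow {m : ℕ∞} {k : ℕ} (hm : m = k) (b : Multiplicative (ZMod m.toNat)) :
    b ^ k = 1 := by
  subst hm
  refine Multiplicative.toAdd.injective ?_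
  rw [toAdd_pow, toAdd_one, nsmul_eq_mul]
  have h : ((k : ℕ) : ZMod (k : ℕ∞).toNat) = 0 := ZMod.natCast_self k
  rw [h, zero_mul]

variable {r : ℕ} {m : ℕ∞} {w : FreeGroup (Fin r)} {S : Set (FreeGroup (Fin r))}
  {H : Subgroup (FreeGroup (Fin r))}

/-- Homomorphisms to `ZMod m.toNat` restrict from `H` to the core and extend back, so they detect
the same elements of the core. -/
lemma memK_coreSubgroup_iff (hS : StepConnected S) (hw : w ∈ S) :
    MemK m w (coreSubgroup S H) ↔ MemK m w H := by
  constructor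
  · rintro ⟨h, hK⟩
    refine ⟨coreSubgroup_le h, mem_KSubgroup_of_forall_hom fun φ => ?_⟩
    exact map_eq_one_of_mem_KSubgroup hK (fun k hk b => Multiplicative.zmod_pow hk b)
      (φ.comp (Subgroup.inclusion coreSubgroup_le))
  · rintro ⟨h, hK⟩
    refine ⟨(mem_coreSubgroup_iff hS.1 hw).2 h, mem_KSubgroup_of_forall_hom fun φ => ?_⟩
    obtain ⟨ψ, hψ⟩ := exists_extend_coreSubgroup hS φ
    rw [← hψ]
    exact map_eq_one_of_mem_KSubgroup hK (fun k hk b => Multiplicative.zmod_pow hk b) ψ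

end MemK

/-! ### Counting permutation representations -/

section Counting

open Nat

/-- Dividing by one extension leaves the permutations fixing the range of `f` pointwise. -/
lemma card_perm_extending {V W : Type*} [Finite V] [Finite W] (f g : V → W) (hf : f.Injective)
    (hg : g.Injective) :
    Nat.card {τ : Equiv.Perm W // ∀ v, τ (f v) = g v} = (Nat.card W - Nat.card V)! := by
  classical
  obtain ⟨σ, hσ⟩ := exists_perm_extending f g hf hg
  have e1 : {τ : Equiv.Perm W // ∀ v, τ (f v) = g v} ≃
      {τ : Equiv.Perm W // ∀ w, ¬ w ∉ Set.range f → τ w = w} :=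
    (Equiv.mulLeft σ⁻¹).subtypeEquiv fun τ => by
      simp only [Equiv.coe_mulLeft, not_not, Set.forall_mem_range, Equiv.Perm.mul_apply,
        Equiv.Perm.inv_eq_iff_eq, hσ]
  rw [Nat.card_congr (e1.trans (Equiv.Perm.subtypeEquivSubtypePerm _).symm), Nat.card_perm]
  congr 1
  have h1 : Nat.card W = Nat.card {w // w ∈ Set.range f} + Nat.card {w // w ∉ Set.range f} := by
    rw [← Nat.card_sum]
    exact Nat.card_congr (Equiv.sumCompl _).symm
  have h2 : Nat.card {w // w ∈ Set.range f} = Nat.card V :=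
    Nat.card_congr (Equiv.ofInjective f hf).symm
  omega

variable {ι X : Type*} {S : Set (FreeGroup ι)}

/-- The permutations `τ i` are compatible with the injection `f` of the visited points. -/
abbrev CompatiblePerm (S : Set (FreeGroup ι)) (a : FreeGroup ι →* Equiv.Perm X) (x : X) {W : Type*}
    (f : visited S a x ↪ W) (i : ι) : Type _ :=
  {τ : Equiv.Perm W // ∀ v : steps S a x i,
    τ (f ⟨v, steps_subset_visited _ _ _ _ v.2⟩) =
      f ⟨a (FreeGroup.of i) v, apply_mem_visited_of_mem_steps v.2⟩}

lemma lift_compatible (hS : StepConnected S) {a : FreeGroup ι →* Equiv.Perm X} {x : X} {W : Type*}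
    (f : visited S a x ↪ W) (τ : ∀ i, CompatiblePerm S a x f i) (hx : x ∈ visited S a x) :
    ∀ s ∈ S, ∀ hs : a s x ∈ visited S a x,
      FreeGroup.lift (fun i => (τ i).1) s (f ⟨x, hx⟩) = f ⟨a s x, hs⟩ := by
  refine hS.2 _ (fun hs => by simp) fun i s hs hs' => ?_
  have e := (τ i).2 ⟨a s x, s, hs, hs', rfl⟩
  have hv : a s x ∈ visited S a x := ⟨s, hs, rfl⟩
  have hv' : a (FreeGroup.of i * s) x ∈ visited S a x := ⟨_, hs', rfl⟩
  have e2 : (⟨a (FreeGroup.of i * s) x, hv'⟩ : visited S a x) =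
      ⟨a (FreeGroup.of i) (a s x), by rwa [map_mul, Equiv.Perm.mul_apply] at hv'⟩ := by
    simp
  constructor
  · intro h _
    rw [map_mul, Equiv.Perm.mul_apply, h hv, FreeGroup.lift_apply_of, e, e2]
  · intro h _
    have h := h hv'
    rw [map_mul, Equiv.Perm.mul_apply, FreeGroup.lift_apply_of, e2, ← e] at h
    exact (τ i).1.injective h

/-- A pair with the same coincidences as `x` amounts to an embedding of the traced graph's vertices
in `Fin N` and, for each generator, a permutation extending its edges. If `N` is too small for an
embedding, the descending factorial is 0. -/
lemma card_marked_actions [Fintype ι] (hS : StepConnected S) (hfin : S.Finite)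
    (a : FreeGroup ι →* Equiv.Perm X) (x : X) (N : ℕ) :
    Nat.card {p : (ι → Equiv.Perm (Fin N)) × Fin N // ∀ s ∈ S, ∀ t ∈ S,
      FreeGroup.lift p.1 s p.2 = FreeGroup.lift p.1 t p.2 ↔ a s x = a t x} =
    N.descFactorial (visited S a x).ncard * ∏ i, (N - (steps S a x i).ncard)! := by
  classical
  have : Finite (visited S a x) := visited_finite hfin a x
  have : ∀ i, Finite (steps S a x i) := steps_finite hfin a x
  have := Fintype.ofFinite (visited S a x)
  have hx : x ∈ visited S a x := ⟨1, hS.1, by simp⟩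
  have hvis : ∀ s ∈ S, a s x ∈ visited S a x := fun s hs => ⟨s, hs, rfl⟩
  let T := Σ f : visited S a x ↪ Fin N, ∀ i, CompatiblePerm S a x f i
  let Φ : T → {p : (ι → Equiv.Perm (Fin N)) × Fin N // ∀ s ∈ S, ∀ t ∈ S,
      FreeGroup.lift p.1 s p.2 = FreeGroup.lift p.1 t p.2 ↔ a s x = a t x} := fun q =>
    ⟨(fun i => (q.2 i).1, q.1 ⟨x, hx⟩), fun s hs t ht => by
      rw [lift_compatible hS q.1 q.2 hx s hs (hvis s hs),
        lift_compatible hS q.1 q.2 hx t ht (hvis t ht)]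
      simp⟩
  have hΦ : Φ.Bijective := by
    constructor
    · rintro ⟨f, τ⟩ ⟨f', τ'⟩ h
      have h1 : (fun i => (τ i).1) = fun i => (τ' i).1 := congrArg (fun p => p.1.1) h
      have h2 : f ⟨x, hx⟩ = f' ⟨x, hx⟩ := congrArg (fun p => p.1.2) h
      have hf : f = f' := by
        refine DFunLike.ext _ _ ?_
        rintro ⟨v, s, hs, rfl⟩
        have e := lift_compatible hS f τ hx s hs (hvis s hs)
        rw [h1, h2] at e
        exact e.symm.trans (lift_compatible hS f' τ' hx s hs (hvis s hs))
      subst hf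
      have : τ = τ' := funext fun i => Subtype.ext (congrFun h1 i)
      rw [this]
    · rintro ⟨⟨σ, j⟩, h⟩
      obtain ⟨t, ht1, ht⟩ := exists_section hS.1 a x
      let f : visited S a x ↪ Fin N := ⟨fun v => FreeGroup.lift σ (t v) j, fun v v' hv => by
        have := (h _ (ht v v.2).1 _ (ht v' v'.2).1).1 hv
        rw [(ht v v.2).2, (ht v' v'.2).2] at this
        exact Subtype.ext this⟩
      have hf : ∀ s ∈ S, ∀ hs : a s x ∈ visited S a x, f ⟨a s x, hs⟩ = FreeGroup.lift σ s j :=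
        fun s hs hv => (h _ (ht _ hv).1 s hs).2 (ht _ hv).2
      refine ⟨⟨f, fun i => ⟨σ i, ?_⟩⟩, ?_⟩
      · rintro ⟨v, s, hs, hs', rfl⟩
        have hv := apply_mem_visited_of_mem_steps (a := a) (x := x) ⟨s, hs, hs', rfl⟩
        have e2 : (⟨a (FreeGroup.of i) (a s x), hv⟩ : visited S a x) =
            ⟨a (FreeGroup.of i * s) x, hvis _ hs'⟩ := by simp
        rw [hf s hs, e2, hf _ hs', map_mul, Equiv.Perm.mul_apply, FreeGroup.lift_apply_of]
      · refine Subtype.ext (Prod.ext rfl ?_)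
        change FreeGroup.lift σ (t x) j = j
        simp [ht1]
  rw [← Nat.card_congr (Equiv.ofBijective Φ hΦ), Nat.card_sigma]
  have hc : ∀ f : visited S a x ↪ Fin N, Nat.card (∀ i, CompatiblePerm S a x f i) =
      ∏ i, (N - (steps S a x i).ncard)! := by
    intro f
    rw [Nat.card_pi]
    refine Finset.prod_congr rfl fun i _ => ?_
    refine (card_perm_extending _ _ ?_ ?_).trans ?_
    · intro v v' h
      have := Subtype.ext_iff.1 (f.injective h)
      exact Subtype.ext this
    · intro v v' h
      have := Subtype.ext_iff.1 (f.injective h)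
      exact Subtype.ext ((a (FreeGroup.of i)).injective this)
    · rw [Nat.card_fin]; rfl
  simp only [hc, Finset.sum_const, Finset.card_univ, smul_eq_mul]
  rw [Fintype.card_embedding_eq, Fintype.card_fin, ← Nat.card_eq_fintype_card]
  rfl

end Counting

/-! ### Asymptotics -/

section Asymptotic

/-- `u N = 1 + O(1 / N)`. -/
def IsOneAddInv (u : ℕ → ℂ) : Prop :=
  (fun N => u N - 1) =O[atTop] fun N : ℕ => (N : ℂ)⁻¹

lemma tendsto_natCast_inv : Tendsto (fun N : ℕ => (N : ℂ)⁻¹) atTop (nhds 0) :=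
  tendsto_inv_atTop_nhds_zero_nat

namespace IsOneAddInv

variable {u v : ℕ → ℂ}

lemma tendsto (hu : IsOneAddInv u) : Tendsto u atTop (nhds 1) := by
  have := (hu.trans_tendsto tendsto_natCast_inv).add_const 1
  simpa using this

lemma mul (hu : IsOneAddInv u) (hv : IsOneAddInv v) : IsOneAddInv fun N => u N * v N := by
  have h1 : (fun N => (u N - 1) * v N) =O[atTop] fun N : ℕ => (N : ℂ)⁻¹ := by
    simpa using IsBigO.mul hu (hv.tendsto.isBigO_one ℂ)
  refine (h1.add hv).congr_left fun N => by ring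

lemma inv (hu : IsOneAddInv u) : IsOneAddInv fun N => (u N)⁻¹ := by
  have ht := hu.tendsto.inv₀ one_ne_zero
  have h1 : (fun N => (1 - u N) * (u N)⁻¹) =O[atTop] fun N : ℕ => (N : ℂ)⁻¹ := by
    have : (fun N => 1 - u N) =O[atTop] fun N : ℕ => (N : ℂ)⁻¹ :=
      (IsBigO.neg_left hu).congr_left fun N => by ring
    simpa using this.mul (ht.isBigO_one ℂ)
  refine h1.congr' ?_ EventuallyEq.rfl
  filter_upwards [hu.tendsto.eventually_ne one_ne_zero] with N hN
  field_simp

lemma one : IsOneAddInv fun _ => 1 := by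
  simp [IsOneAddInv, isBigO_zero]

lemma prod {κ : Type*} (s : Finset κ) {f : κ → ℕ → ℂ} (hf : ∀ i, IsOneAddInv (f i)) :
    IsOneAddInv fun N => ∏ i ∈ s, f i N := by
  classical
  induction s using Finset.induction_on with
  | empty => simpa using one
  | insert i s hi ih => simpa [Finset.prod_insert hi] using (hf i).mul ih

lemma congr' (hu : IsOneAddInv u) (h : u =ᶠ[atTop] v) : IsOneAddInv v := by
  refine IsBigO.congr' hu ?_ EventuallyEq.rfl
  filter_upwards [h] with N hN
  rw [hN]

end IsOneAddInv

lemma isOneAddInv_descFactorial (k : ℕ) :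
    IsOneAddInv fun N => (N.descFactorial k : ℂ) / (N : ℂ) ^ k := by
  induction k with
  | zero => simpa using IsOneAddInv.one
  | succ k ih =>
    have h1 : IsOneAddInv fun N : ℕ => ((N : ℂ) - k) / N := by
      have h0 : (fun N : ℕ => -(k : ℂ) * (N : ℂ)⁻¹) =O[atTop] fun N : ℕ => (N : ℂ)⁻¹ :=
        (isBigO_refl _ _).const_mul_left _
      refine h0.congr' ?_ EventuallyEq.rfl
      filter_upwards [eventually_gt_atTop 0] with N hN
      have : (N : ℂ) ≠ 0 := by exact_mod_cast hN.ne'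
      field_simp
      ring
    refine (h1.mul ih).congr' ?_
    filter_upwards [eventually_ge_atTop k] with N hN
    rw [Nat.descFactorial_succ, Nat.cast_mul, Nat.cast_sub hN, pow_succ]
    rw [div_mul_div_comm, mul_comm (N : ℂ)]

/-- Each quotient `(N - e)! / N!` is the inverse of a descending factorial, so only the powers `N^V
/ ∏ N^(e i) = N^(1 - n)` remain, up to a factor `1 + O(1/N)`. -/
lemma isBigO_descFactorial_mul_prod {ι : Type*} [Fintype ι] (V n : ℕ) (e : ι → ℕ)
    (hn : n + V = ∑ i, e i + 1) :
    (fun N : ℕ => ((N.descFactorial V * ∏ i, (N - e i).factorial : ℕ) : ℂ) /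
        (N.factorial : ℂ) ^ Fintype.card ι - (N : ℂ) ^ (1 - (n : ℤ))) =O[atTop]
      fun N : ℕ => (N : ℂ) ^ (1 - (n : ℤ) + -1) := by
  have h1 : IsOneAddInv fun N : ℕ => (N.descFactorial V : ℂ) / (N : ℂ) ^ V *
      ∏ i, ((N.descFactorial (e i) : ℂ) / (N : ℂ) ^ e i)⁻¹ :=
    (isOneAddInv_descFactorial V).mul
      (IsOneAddInv.prod _ fun i => (isOneAddInv_descFactorial (e i)).inv)
  have h2 := (isBigO_refl (fun N : ℕ => (N : ℂ) ^ (1 - (n : ℤ))) atTop).mul h1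
  refine h2.congr' ?_ ?_
  · filter_upwards [eventually_gt_atTop 0, eventually_ge_atTop (∑ i, e i)] with N hN hN'
    have hN0 : (N : ℂ) ≠ 0 := by exact_mod_cast hN.ne'
    have he : ∀ i, e i ≤ N := fun i =>
      (Finset.single_le_sum (fun _ _ => Nat.zero_le _) (Finset.mem_univ i)).trans hN'
    have e1 : ∀ i, ((N - e i).factorial : ℂ) / N.factorial = (N.descFactorial (e i) : ℂ)⁻¹ := by
      intro i
      have h := Nat.factorial_mul_descFactorial (he i)
      have hf : ((N - e i).factorial : ℂ) ≠ 0 := by exact_mod_cast Nat.factorial_ne_zero _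
      rw [← h, Nat.cast_mul, ← div_div, div_self hf, one_div]
    have e2 : ((N.descFactorial V * ∏ i, (N - e i).factorial : ℕ) : ℂ) /
        (N.factorial : ℂ) ^ Fintype.card ι =
        (N.descFactorial V : ℂ) * ∏ i, (N.descFactorial (e i) : ℂ)⁻¹ := by
      rw [Nat.cast_mul, Nat.cast_prod, mul_div_assoc]
      congr 1
      rw [← Finset.card_univ, ← Finset.prod_const, ← Finset.prod_div_distrib]
      exact Finset.prod_congr rfl fun i _ => e1 i
    rw [e2]
    have e3 : (N : ℂ) ^ (1 - (n : ℤ)) = (N : ℂ) ^ V / ∏ i, (N : ℂ) ^ e i := by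
      rw [Finset.prod_pow_eq_pow_sum, eq_div_iff (pow_ne_zero _ hN0), ← zpow_natCast,
        ← zpow_natCast, ← zpow_add₀ hN0]
      congr 1
      have : (n : ℤ) + V = (∑ i, e i : ℕ) + 1 := by exact_mod_cast hn
      linarith
    have e4 : ∏ i, ((N.descFactorial (e i) : ℂ) / (N : ℂ) ^ e i)⁻¹ =
        (∏ i, (N : ℂ) ^ e i) * ∏ i, (N.descFactorial (e i) : ℂ)⁻¹ := by
      rw [← Finset.prod_mul_distrib]
      exact Finset.prod_congr rfl fun i _ => by rw [inv_div, div_eq_mul_inv]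
    have hP : ∏ i, (N : ℂ) ^ e i ≠ 0 := Finset.prod_ne_zero_iff.2 fun i _ => pow_ne_zero _ hN0
    have hV : (N : ℂ) ^ V ≠ 0 := pow_ne_zero _ hN0
    rw [e4, mul_sub, mul_one, e3]
    congr 1
    field_simp
  · filter_upwards [eventually_gt_atTop 0] with N hN
    have hN0 : (N : ℂ) ≠ 0 := by exact_mod_cast hN.ne'
    rw [zpow_add₀ hN0, zpow_neg_one]

end Asymptotic

/-! ### The generalized symmetric groups acting on columns -/

section Wreath

/-- The roots of unity of order dividing `m`, or all of the circle if `m = ∞`. -/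
def phaseGroup (m : ℕ∞) : Subgroup Circle where
  carrier := {z | ∀ k : ℕ, m = k → z ^ k = 1}
  mul_mem' hz hy k hk := by rw [mul_pow, hz k hk, hy k hk, one_mul]
  one_mem' k _ := one_pow k
  inv_mem' hz k hk := by rw [inv_pow, hz k hk, inv_one]

lemma phaseGroup_pow {m : ℕ∞} {k : ℕ} (hk : m = k) (z : phaseGroup m) : z ^ k = 1 :=
  Subtype.ext (z.2 k hk)

/-- The invertible matrix which maps the `j`-th basis vector to `y j` times the `π j`-th one. -/
noncomputable def columnUnit {N : ℕ} {m : ℕ∞} (π : Equiv.Perm (Fin N)) (y : Fin N → phaseGroup m) :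
    GL (Fin N) ℂ :=
  monomialUnit π⁻¹ fun i => (y (π⁻¹ i) : Circle)

variable {N : ℕ} {m : ℕ∞}

lemma columnUnit_apply (π : Equiv.Perm (Fin N)) (y : Fin N → phaseGroup m) (i j : Fin N) :
    (columnUnit π y : Matrix (Fin N) (Fin N) ℂ) i j = if π j = i then ((y j : Circle) : ℂ) else 0 := by
  change monomialMatrix π⁻¹ (fun i => (y (π⁻¹ i) : Circle)) i j = _
  by_cases h : π j = i
  · subst h; simp [monomialMatrix]
  · have : π⁻¹ i ≠ j := fun e => h (by simp [← e])
    rw [if_neg h]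
    exact if_neg this

/-- Indexing by columns keeps the order of the permutations, which `monomialUnit_mul` reverses, and
gives the phases the form of a left cocycle. -/
lemma columnUnit_mul (π ρ : Equiv.Perm (Fin N)) (y z : Fin N → phaseGroup m) :
    columnUnit π y * columnUnit ρ z = columnUnit (π * ρ) fun j => y (ρ j) * z j := by
  rw [columnUnit, columnUnit, monomialUnit_mul, columnUnit, mul_inv_rev]
  congr 1
  ext i
  simp

lemma columnUnit_apply_ne_zero_iff (π : Equiv.Perm (Fin N)) (y : Fin N → phaseGroup m)
    (i j : Fin N) : (columnUnit π y : Matrix (Fin N) (Fin N) ℂ) i j ≠ 0 ↔ π j = i := by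
  rw [columnUnit_apply]
  by_cases h : π j = i <;> simp [h]

lemma mem_genSymGroup_iff (A : GL (Fin N) ℂ) :
    A ∈ genSymGroup m N ↔ ∃ (π : Equiv.Perm (Fin N)) (y : Fin N → phaseGroup m),
      A = columnUnit π y := by
  have key : A ∈ genSymGroup m N ↔ ∃ (σ : Equiv.Perm (Fin N)) (z : Fin N → Circle),
      A = monomialUnit σ z ∧ ∀ i, z i ∈ phaseGroup m := by
    rcases m with _ | k
    · refine (isCircleMonomial_coe_iff A).trans ?_
      refine exists_congr fun σ => exists_congr fun z => (and_iff_left fun i k hk => ?_).symm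
      exact absurd hk (ENat.top_ne_natCast k)
    · constructor
      · rintro ⟨h1, h2⟩
        obtain ⟨σ, z, rfl⟩ := (isCircleMonomial_coe_iff A).1 h1
        refine ⟨σ, z, rfl, fun i l hl => ?_⟩
        obtain rfl : k = l := ENat.natCast_inj.1 hl
        exact (monomialMatrix_pow_iff k σ z).1 h2 i
      · rintro ⟨σ, z, rfl, h⟩
        exact ⟨(isCircleMonomial_coe_iff _).2 ⟨σ, z, rfl⟩,
          (monomialMatrix_pow_iff k σ z).2 fun i => h i k rfl⟩
  rw [key]
  constructor
  · rintro ⟨σ, z, rfl, h⟩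
    refine ⟨σ⁻¹, fun j => ⟨z (σ⁻¹ j), h _⟩, ?_⟩
    simp [columnUnit]
  · rintro ⟨π, y, rfl⟩
    exact ⟨π⁻¹, _, rfl, fun i => (y _).2⟩

/-- `columnUnit` as an element of `genSymGroup`. -/
noncomputable def columnElt (π : Equiv.Perm (Fin N)) (y : Fin N → phaseGroup m) :
    genSymGroup m N :=
  ⟨columnUnit π y, (mem_genSymGroup_iff _).2 ⟨π, y, rfl⟩⟩

lemma columnElt_mul (π ρ : Equiv.Perm (Fin N)) (y z : Fin N → phaseGroup m) :
    columnElt π y * columnElt ρ z = columnElt (π * ρ) fun j => y (ρ j) * z j :=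
  Subtype.ext (columnUnit_mul π ρ y z)

lemma exists_eq_columnElt (A : genSymGroup m N) : ∃ π y, A = columnElt π y := by
  obtain ⟨π, y, h⟩ := (mem_genSymGroup_iff _).1 A.2
  exact ⟨π, y, Subtype.ext h⟩

variable {r : ℕ}

lemma lift_columnElt {σ : Fin r → Equiv.Perm (Fin N)} {y : Fin r → Fin N → phaseGroup m}
    {c : FreeGroup (Fin r) → Fin N → phaseGroup m} (hc : IsPermCocycle (FreeGroup.lift σ) c)
    (hy : ∀ i x, c (FreeGroup.of i) x = y i x) (w : FreeGroup (Fin r)) :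
    FreeGroup.lift (fun i => columnElt (σ i) (y i)) w = columnElt (FreeGroup.lift σ w) (c w) := by
  let f : FreeGroup (Fin r) →* genSymGroup m N :=
    MonoidHom.mk' (fun u => columnElt (FreeGroup.lift σ u) (c u)) fun u v => by
      rw [columnElt_mul, map_mul]
      congr 1
      ext1 j
      exact hc u v j
  have : FreeGroup.lift (fun i => columnElt (σ i) (y i)) = f := by
    refine FreeGroup.ext_hom _ _ fun i => ?_
    rw [FreeGroup.lift_apply_of]
    change _ = columnElt (FreeGroup.lift σ (FreeGroup.of i)) (c (FreeGroup.of i))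
    rw [FreeGroup.lift_apply_of, funext (hy i)]
  rw [this]
  rfl

/-- The tuples of matrices with underlying permutations `σ`. -/
def tupleCell (m : ℕ∞) (σ : Fin r → Equiv.Perm (Fin N)) : Set (Fin r → genSymGroup m N) :=
  {A | ∀ i j, ((A i : GL (Fin N) ℂ) : Matrix (Fin N) (Fin N) ℂ) (σ i j) j ≠ 0}

lemma mem_tupleCell_columnElt {σ τ : Fin r → Equiv.Perm (Fin N)}
    {y : Fin r → Fin N → phaseGroup m} :
    (fun i => columnElt (τ i) (y i)) ∈ tupleCell m σ ↔ τ = σ := by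
  constructor
  · intro h
    ext1 i
    ext1 j
    exact (columnUnit_apply_ne_zero_iff _ _ _ _).1 (h i j)
  · rintro rfl i j
    exact (columnUnit_apply_ne_zero_iff _ _ _ _).2 rfl

lemma exists_eq_columnElt_tuple (A : Fin r → genSymGroup m N) :
    ∃ (τ : Fin r → Equiv.Perm (Fin N)) (y : Fin r → Fin N → phaseGroup m),
      A = fun i => columnElt (τ i) (y i) := by
  choose τ y h using fun i => exists_eq_columnElt (A i)
  exact ⟨τ, y, funext h⟩

lemma mem_tupleCell_iff {σ : Fin r → Equiv.Perm (Fin N)} {A : Fin r → genSymGroup m N} :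
    A ∈ tupleCell m σ ↔ ∃ y : Fin r → Fin N → phaseGroup m, A = fun i => columnElt (σ i) (y i) := by
  constructor
  · intro h
    obtain ⟨τ, y, rfl⟩ := exists_eq_columnElt_tuple A
    rw [mem_tupleCell_columnElt] at h
    exact ⟨y, by rw [h]⟩
  · rintro ⟨y, rfl⟩
    exact mem_tupleCell_columnElt.2 rfl

lemma existsUnique_mem_tupleCell (A : Fin r → genSymGroup m N) : ∃! σ, A ∈ tupleCell m σ := by
  obtain ⟨τ, y, rfl⟩ := exists_eq_columnElt_tuple A
  exact ⟨τ, mem_tupleCell_columnElt.2 rfl, fun σ h => (mem_tupleCell_columnElt.1 h).symm⟩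

lemma mul_mem_tupleCell_iff (τ : Fin r → Equiv.Perm (Fin N)) (y : Fin r → Fin N → phaseGroup m)
    (σ : Fin r → Equiv.Perm (Fin N)) (A : Fin r → genSymGroup m N) :
    (fun i => columnElt (τ i) (y i)) * A ∈ tupleCell m (τ * σ) ↔ A ∈ tupleCell m σ := by
  obtain ⟨ρ, z, rfl⟩ := exists_eq_columnElt_tuple A
  have : ((fun i => columnElt (τ i) (y i)) * fun i => columnElt (ρ i) (z i)) =
      fun i => columnElt ((τ * ρ) i) (fun j => y i (ρ i j) * z i j) :=
    funext fun i => columnElt_mul _ _ _ _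
  rw [this, mem_tupleCell_columnElt, mem_tupleCell_columnElt, mul_right_inj]

end Wreath

/-! ### Integration over tuples of Haar random matrices -/

section Haar

variable {N r : ℕ} {m : ℕ∞}

instance : SecondCountableTopology (GL (Fin N) ℂ) :=
  have : SecondCountableTopology (Matrix (Fin N) (Fin N) ℂ) :=
    inferInstanceAs (SecondCountableTopology (Fin N → Fin N → ℂ))
  have : SecondCountableTopology (Matrix (Fin N) (Fin N) ℂ)ᵐᵒᵖ :=
    MulOpposite.opHomeomorph.symm.secondCountableTopology
  (Units.isEmbedding_embedProduct (M := Matrix (Fin N) (Fin N) ℂ)).isInducing.secondCountableTopology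

instance : SecondCountableTopology (genSymGroup m N) :=
  TopologicalSpace.Subtype.secondCountableTopology (genSymGroup m N : Set (GL (Fin N) ℂ))

instance : OpensMeasurableSpace (Fin r → genSymGroup m N) :=
  Pi.opensMeasurableSpace

instance : (haarProb m N).IsMulLeftInvariant := by
  unfold haarProb
  infer_instance

/-- The diagonal entry `j` of the evaluation of a word. -/
noncomputable def diagEntry (w : FreeGroup (Fin r)) (j : Fin N) (A : Fin r → genSymGroup m N) : ℂ :=
  (((FreeGroup.lift A w : genSymGroup m N) : GL (Fin N) ℂ) : Matrix (Fin N) (Fin N) ℂ) j j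

lemma continuous_lift_apply {ι G : Type*} [Group G] [TopologicalSpace G] [IsTopologicalGroup G]
    (w : FreeGroup ι) : Continuous fun A : ι → G => FreeGroup.lift A w := by
  induction w using FreeGroup.induction_on with
  | C1 => simpa using continuous_const
  | of i => simpa using continuous_apply i
  | inv_of i h =>
    simp only [map_inv, FreeGroup.lift_apply_of]
    exact (continuous_apply i).inv
  | mul u v hu hv =>
    simp only [map_mul]
    exact hu.mul hv

lemma continuous_genSymGroup_entry (i j : Fin N) : Continuous fun A : genSymGroup m N =>
    ((A : GL (Fin N) ℂ) : Matrix (Fin N) (Fin N) ℂ) i j :=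
  ((Units.continuous_val (M := Matrix (Fin N) (Fin N) ℂ)).comp continuous_subtype_val).matrix_elem
    i j

lemma continuous_diagEntry (w : FreeGroup (Fin r)) (j : Fin N) :
    Continuous (diagEntry (m := m) w j) :=
  (continuous_genSymGroup_entry j j).comp (continuous_lift_apply w)

lemma integrable_diagEntry (w : FreeGroup (Fin r)) (j : Fin N) :
    Integrable (diagEntry (m := m) w j) (Measure.pi fun _ => haarProb m N) :=
  (continuous_diagEntry w j).integrable_of_hasCompactSupport
    (HasCompactSupport.of_compactSpace _)

lemma measurableSet_tupleCell (σ : Fin r → Equiv.Perm (Fin N)) :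
    MeasurableSet (tupleCell m σ) := by
  have : tupleCell m σ = ⋂ i, ⋂ j, {A : Fin r → genSymGroup m N |
      ((A i : GL (Fin N) ℂ) : Matrix (Fin N) (Fin N) ℂ) (σ i j) j ≠ 0} := by
    ext A
    simp [tupleCell]
  rw [this]
  refine MeasurableSet.iInter fun i => MeasurableSet.iInter fun j => ?_
  exact (isOpen_ne_fun ((continuous_genSymGroup_entry _ _).comp (continuous_apply i))
    continuous_const).measurableSet

/-- The `(N!)^r` cells partition the group and are left translates of each other. -/
lemma measure_tupleCell (σ : Fin r → Equiv.Perm (Fin N)) :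
    (Measure.pi fun _ : Fin r => haarProb m N).real (tupleCell m σ) =
      ((N.factorial : ℝ) ^ r)⁻¹ := by
  set μ := Measure.pi fun _ : Fin r => haarProb m N
  have h1 : ∀ τ : Fin r → Equiv.Perm (Fin N), μ.real (tupleCell m τ) = μ.real (tupleCell m σ) := by
    intro τ
    have h := measure_preimage_mul μ (fun i => columnElt ((σ * τ⁻¹) i) fun _ => 1) (tupleCell m σ)
    rw [Measure.real, Measure.real, ← h]
    congr 2
    ext A
    have := mul_mem_tupleCell_iff (m := m) (σ * τ⁻¹) (fun _ _ => 1) τ A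
    rw [inv_mul_cancel_right] at this
    exact this.symm
  have h2 : ∑ τ : Fin r → Equiv.Perm (Fin N), μ.real (tupleCell m τ) = 1 := by
    rw [← measureReal_biUnion_finset]
    · have : (⋃ τ ∈ (Finset.univ : Finset (Fin r → Equiv.Perm (Fin N))), tupleCell m τ) =
          Set.univ := by
        ext A
        obtain ⟨τ, h, -⟩ := existsUnique_mem_tupleCell A
        simpa using ⟨τ, h⟩
      rw [this]
      simp
    · intro τ _ τ' _ hne
      refine Set.disjoint_left.2 fun A h h' => hne ?_
      exact (existsUnique_mem_tupleCell A).unique h h'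
    · exact fun τ _ => measurableSet_tupleCell τ
  simp only [h1, Finset.sum_const, Finset.card_univ, nsmul_eq_mul] at h2
  rw [Fintype.card_fun, Fintype.card_perm, Fintype.card_fin, Fintype.card_fin, Nat.cast_pow] at h2
  exact eq_inv_of_mul_eq_one_right h2

lemma diagEntry_columnElt {σ : Fin r → Equiv.Perm (Fin N)} {y : Fin r → Fin N → phaseGroup m}
    {c : FreeGroup (Fin r) → Fin N → phaseGroup m} (hc : IsPermCocycle (FreeGroup.lift σ) c)
    (hy : ∀ i x, c (FreeGroup.of i) x = y i x) (w : FreeGroup (Fin r)) (j : Fin N) :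
    diagEntry w j (fun i => columnElt (σ i) (y i)) =
      if FreeGroup.lift σ w j = j then ((c w j : Circle) : ℂ) else 0 := by
  rw [diagEntry, lift_columnElt hc hy]
  exact columnUnit_apply _ _ _ _

/-- Characters of cyclic groups separate points. -/
lemma exists_hom_phaseGroup (hm : 2 ≤ m) (d : Multiplicative (ZMod m.toNat)) (hd : d ≠ 1) :
    ∃ χ : Multiplicative (ZMod m.toNat) →* phaseGroup m, χ d ≠ 1 := by
  suffices h : ∃ χ : Multiplicative (ZMod m.toNat) →* Circle, χ d ≠ 1 by
    obtain ⟨χ, hχ⟩ := h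
    refine ⟨χ.codRestrict (phaseGroup m) fun x k hk => ?_, fun e => hχ ?_⟩
    · rw [← map_pow, Multiplicative.zmod_pow hk, map_one]
    · exact congrArg Subtype.val e
  rcases m with _ | k
  · change Multiplicative ℤ at d
    let z : ℤ := Multiplicative.toAdd d
    have hz : (z : ℝ) ≠ 0 := by
      have : z ≠ 0 := fun e => hd (Multiplicative.toAdd.injective e)
      exact_mod_cast this
    -- The base is chosen so that its `z`-th power is `exp(πi) = -1`.
    refine ⟨zpowersHom Circle (Circle.exp (Real.pi / z)), ?_⟩
    change Circle.exp (Real.pi / z) ^ z ≠ 1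
    intro h
    have h' : Circle.exp Real.pi = 1 := by
      rw [← h, ← Circle.exp_zsmul, zsmul_eq_mul, mul_div_cancel₀ _ hz]
    have := congrArg (fun z : Circle => (z : ℂ)) h'
    norm_num [Circle.coe_exp] at this
  · have hk : k ≠ 0 := by
      rintro rfl
      exact absurd (Nat.cast_le.1 (show ((2 : ℕ) : ℕ∞) ≤ ((0 : ℕ) : ℕ∞) from hm)) (by norm_num)
    have : NeZero k := ⟨hk⟩
    change Multiplicative (ZMod k) at d
    refine ⟨(ZMod.toCircle (N := k)).toMonoidHom, fun h => hd ?_⟩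
    have h' : ZMod.toCircle (Multiplicative.toAdd d) = ZMod.toCircle (0 : ZMod k) := by
      rw [AddChar.map_zero_eq_one]
      exact h
    exact Multiplicative.toAdd.injective (ZMod.injective_toCircle h')

lemma integral_tupleCell_diagEntry_of_memK {w : FreeGroup (Fin r)} {j : Fin N}
    {σ : Fin r → Equiv.Perm (Fin N)} (h : MemK m w (pointStab (FreeGroup.lift σ) j)) :
    ∫ A in tupleCell m σ, diagEntry w j A ∂(Measure.pi fun _ => haarProb m N) =
      ((N.factorial : ℂ) ^ r)⁻¹ := by
  obtain ⟨hw, hK⟩ := h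
  have h1 : ∀ A ∈ tupleCell m σ, diagEntry w j A = 1 := by
    intro A hA
    obtain ⟨y, rfl⟩ := mem_tupleCell_iff.1 hA
    obtain ⟨c, hc, hy⟩ := exists_isPermCocycle (FreeGroup.lift σ) y
    rw [diagEntry_columnElt hc hy, if_pos (mem_pointStab.1 hw)]
    have := map_eq_one_of_mem_KSubgroup hK (fun k hk b => phaseGroup_pow hk b) (hc.monodromy j)
    rw [hc.monodromy_apply] at this
    simp only [this]
    simp
  rw [setIntegral_congr_fun (measurableSet_tupleCell σ) h1, setIntegral_const, measure_tupleCell]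
  simp

/-- Either `w` moves `j` and the entry is 0, or a homomorphism from the stabilizer to the phases is
nontrivial at `w`. It extends to a cocycle `d`, and left translation by a diagonal tuple multiplies
the entry by `d w j ≠ 1`, so invariance of Haar measure kills the integral. -/
lemma integral_tupleCell_diagEntry_of_not_memK (hm : 2 ≤ m) {w : FreeGroup (Fin r)} {j : Fin N}
    {σ : Fin r → Equiv.Perm (Fin N)} (h : ¬ MemK m w (pointStab (FreeGroup.lift σ) j)) :
    ∫ A in tupleCell m σ, diagEntry w j A ∂(Measure.pi fun _ => haarProb m N) = 0 := by
  by_cases hw : w ∈ pointStab (FreeGroup.lift σ) j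
  swap
  · refine setIntegral_eq_zero_of_forall_eq_zero fun A hA => ?_
    obtain ⟨y, rfl⟩ := mem_tupleCell_iff.1 hA
    obtain ⟨c, hc, hy⟩ := exists_isPermCocycle (FreeGroup.lift σ) y
    rw [diagEntry_columnElt hc hy, if_neg (fun e => hw (mem_pointStab.2 e))]
  obtain ⟨φ, hφ⟩ : ∃ φ : pointStab (FreeGroup.lift σ) j →* Multiplicative (ZMod m.toNat),
      φ ⟨w, hw⟩ ≠ 1 := by
    by_contra! hcon
    exact h ⟨hw, mem_KSubgroup_of_forall_hom hcon⟩
  obtain ⟨χ, hχ⟩ := exists_hom_phaseGroup hm _ hφ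
  -- No finiteness is needed here, so all of the free group serves as `S`.
  have hS : StepConnected (Set.univ : Set (FreeGroup (Fin r))) := by
    refine ⟨trivial, fun p h1 hp s _ => ?_⟩
    refine (stepConnected_suffixSet s.toWord).2 p h1 (fun i s _ _ => hp i s trivial trivial) s ?_
    have := mk_mem_suffixSet s.toWord
    rwa [FreeGroup.mk_toWord] at this
  obtain ⟨t, ht1, ht⟩ := exists_section hS.1 (FreeGroup.lift σ) j
  obtain ⟨d, hd, -, -, hdφ⟩ := exists_cocycle_extending hS ht1 ht
    ((χ.comp φ).comp (Subgroup.inclusion coreSubgroup_le)) (fun _ => 1) rfl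
  have hdw : d w j ≠ 1 := by
    have := hdφ ⟨w, (mem_coreSubgroup_iff hS.1 trivial).2 hw⟩
    exact fun e => hχ (this.symm.trans e)
  set μ := Measure.pi fun _ : Fin r => haarProb m N
  -- Left multiplication scales rows; the inverse of `σ i` transports the cocycle from columns to
  -- rows.
  let D : Fin r → genSymGroup m N := fun i =>
    columnElt 1 fun x => d (FreeGroup.of i) ((σ i)⁻¹ x)
  have key : ∀ A, (tupleCell m σ).indicator (diagEntry w j) (D * A) =
      ((d w j : Circle) : ℂ) * (tupleCell m σ).indicator (diagEntry w j) A := by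
    intro A
    have hmem : D * A ∈ tupleCell m σ ↔ A ∈ tupleCell m σ := by
      have := mul_mem_tupleCell_iff (m := m) 1 (fun i x => d (FreeGroup.of i) ((σ i)⁻¹ x)) σ A
      rwa [one_mul] at this
    by_cases hA : A ∈ tupleCell m σ
    · rw [Set.indicator_of_mem hA, Set.indicator_of_mem (hmem.2 hA)]
      obtain ⟨y, rfl⟩ := mem_tupleCell_iff.1 hA
      obtain ⟨c, hc, hy⟩ := exists_isPermCocycle (FreeGroup.lift σ) y
      have hDA : D * (fun i => columnElt (σ i) (y i)) =
          fun i => columnElt (σ i) fun x => d (FreeGroup.of i) x * y i x := by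
        funext i
        rw [Pi.mul_apply, columnElt_mul, one_mul]
        simp
      have hdc : IsPermCocycle (FreeGroup.lift σ) fun u x => d u x * c u x := fun u v x => by
        change d (u * v) x * c (u * v) x = _
        rw [hd, hc, mul_mul_mul_comm]
      rw [hDA, diagEntry_columnElt hdc (fun i x => by rw [hy]), diagEntry_columnElt hc hy,
        if_pos (mem_pointStab.1 hw), if_pos (mem_pointStab.1 hw)]
      simp
    · rw [Set.indicator_of_notMem hA, Set.indicator_of_notMem (fun h => hA (hmem.1 h)), mul_zero]
  have h1 := integral_mul_left_eq_self (μ := μ) ((tupleCell m σ).indicator (diagEntry w j)) D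
  simp only [key] at h1
  rw [integral_const_mul, integral_indicator (measurableSet_tupleCell σ)] at h1
  by_contra hne
  have := mul_right_cancel₀ hne (h1.trans (one_mul _).symm)
  exact hdw (Subtype.ext (Circle.ext this))

/-- The expected trace counts the pairs of a permutation representation and a point such that
`w` belongs to `K_m` of the stabilizer of the point. -/
lemma expectedTrace_eq_card (hm : 2 ≤ m) (w : FreeGroup (Fin r)) :
    expectedTrace w m N = (Nat.card {p : (Fin r → Equiv.Perm (Fin N)) × Fin N //
      MemK m w (pointStab (FreeGroup.lift p.1) p.2)} : ℂ) / (N.factorial : ℂ) ^ r := by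
  classical
  set μ := Measure.pi fun _ : Fin r => haarProb m N with hμ
  have h1 : expectedTrace w m N = ∑ j : Fin N, ∫ A, diagEntry w j A ∂μ := by
    rw [← integral_finsetSum _ fun j _ => integrable_diagEntry w j]
    rfl
  have h2 : ∀ j : Fin N, ∫ A, diagEntry w j A ∂μ =
      ∑ σ : Fin r → Equiv.Perm (Fin N), ∫ A in tupleCell m σ, diagEntry w j A ∂μ := by
    intro j
    rw [← integral_iUnion_fintype (fun σ => measurableSet_tupleCell σ) ?_
      fun σ => (integrable_diagEntry w j).integrableOn]
    · have : (⋃ τ : Fin r → Equiv.Perm (Fin N), tupleCell m τ) = Set.univ := by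
        ext A
        obtain ⟨τ, h, -⟩ := existsUnique_mem_tupleCell A
        simpa using ⟨τ, h⟩
      rw [this, setIntegral_univ]
    · intro τ τ' hne
      refine Set.disjoint_left.2 fun A h h' => hne ?_
      exact (existsUnique_mem_tupleCell A).unique h h'
  have h3 : ∀ (j : Fin N) (σ : Fin r → Equiv.Perm (Fin N)),
      ∫ A in tupleCell m σ, diagEntry w j A ∂μ =
      if MemK m w (pointStab (FreeGroup.lift σ) j) then ((N.factorial : ℂ) ^ r)⁻¹ else 0 := by
    intro j σ
    split_ifs with h
    · exact integral_tupleCell_diagEntry_of_memK h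
    · exact integral_tupleCell_diagEntry_of_not_memK hm h
  simp only [h1, h2, h3]
  rw [Finset.sum_comm, ← Fintype.sum_prod_type'
    (f := fun (σ : Fin r → Equiv.Perm (Fin N)) (j : Fin N) =>
      if MemK m w (pointStab (FreeGroup.lift σ) j) then ((N.factorial : ℂ) ^ r)⁻¹ else 0),
    ← Finset.sum_filter, Finset.sum_const, nsmul_eq_mul, div_eq_mul_inv,
    Nat.card_eq_fintype_card, Fintype.card_subtype]

end Haar

/-! ### The expansion of the expected trace -/

section Expansion

variable {r : ℕ} {m : ℕ∞} {w : FreeGroup (Fin r)} {S : Set (FreeGroup (Fin r))}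

/-- The subgroups `K` with `w ∈ K_m(K)` which are generated along `S`. -/
def coreWitnesses (m : ℕ∞) (w : FreeGroup (Fin r)) (S : Set (FreeGroup (Fin r))) :
    Set (Subgroup (FreeGroup (Fin r))) :=
  {K | coreSubgroup S K = K ∧ MemK m w K}

lemma finite_coreWitnesses (hfin : S.Finite) : (coreWitnesses m w S).Finite :=
  (finite_range_coreSubgroup hfin).subset fun K hK => ⟨K, hK.1⟩

lemma coreSubgroup_mem_coreWitnesses (hS : StepConnected S) (hw : w ∈ S)
    {H : Subgroup (FreeGroup (Fin r))} (hH : MemK m w H) :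
    coreSubgroup S H ∈ coreWitnesses m w S :=
  ⟨coreSubgroup_idem, (memK_coreSubgroup_iff hS hw).2 hH⟩

/-- The number of pairs of a permutation representation and a point with a given core subgroup of
the stabilizer. -/
noncomputable def coreCount (S : Set (FreeGroup (Fin r))) (K : Subgroup (FreeGroup (Fin r)))
    (N : ℕ) : ℕ :=
  Nat.card {p : (Fin r → Equiv.Perm (Fin N)) × Fin N //
    coreSubgroup S (pointStab (FreeGroup.lift p.1) p.2) = K}

lemma expectedTrace_eq_sum (hm : 2 ≤ m) (hS : StepConnected S) (hfin : S.Finite) (hw : w ∈ S)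
    (N : ℕ) : expectedTrace w m N =
      ∑ K ∈ (finite_coreWitnesses (m := m) (w := w) hfin).toFinset,
        (coreCount S K N : ℂ) / (N.factorial : ℂ) ^ r := by
  classical
  rw [expectedTrace_eq_card hm, ← Finset.sum_div, ← Nat.cast_sum]
  congr 2
  rw [Nat.card_eq_fintype_card, Fintype.card_subtype,
    Finset.card_eq_sum_card_fiberwise
      (f := fun p : (Fin r → Equiv.Perm (Fin N)) × Fin N =>
        coreSubgroup S (pointStab (FreeGroup.lift p.1) p.2))
      (t := (finite_coreWitnesses (m := m) (w := w) hfin).toFinset)]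
  · refine Finset.sum_congr rfl fun K hK => ?_
    rw [coreCount, Nat.card_eq_fintype_card, Fintype.card_subtype, Finset.filter_filter]
    congr 1
    refine Finset.filter_congr fun p _ => and_iff_right_of_imp ?_
    rintro rfl
    exact (memK_coreSubgroup_iff hS hw).1 ((Set.Finite.mem_toFinset _).1 hK).2
  · intro p hp
    simp only [Finset.coe_filter, Finset.mem_univ, true_and, Set.mem_ofPred_eq] at hp
    simpa using coreSubgroup_mem_coreWitnesses hS hw hp

/-- The coset action of `K` provides the model graph; pairs with core `K` are those sharing its
coincidences. -/
lemma isBigO_coreCount (hS : StepConnected S) (hfin : S.Finite)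
    {K : Subgroup (FreeGroup (Fin r))} (hK : coreSubgroup S K = K) {n : ℕ}
    (hn : freeGroupRank K = n) :
    (fun N : ℕ => (coreCount S K N : ℂ) / (N.factorial : ℂ) ^ r - (N : ℂ) ^ (1 - (n : ℤ)))
      =O[atTop] fun N : ℕ => (N : ℂ) ^ (1 - (n : ℤ) + -1) := by
  obtain ⟨X, a, x, rfl⟩ : ∃ (X : Type) (a : FreeGroup (Fin r) →* Equiv.Perm X) (x : X),
      pointStab a x = K := ⟨_, _, _, exists_action K⟩
  obtain ⟨n', hn', hr⟩ := freeGroupRank_coreSubgroup hS hfin a x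
  rw [hK, hn] at hn'
  obtain rfl : n = n' := by exact_mod_cast hn'
  have := isBigO_descFactorial_mul_prod _ _ _ hr
  rw [Fintype.card_fin] at this
  refine this.congr_left fun N => ?_
  rw [← card_marked_actions hS hfin a x N, coreCount]
  simp only [coreSubgroup_eq_iff hK, inv_mul_mem_pointStab]

/-! ### The exponent and the critical subgroups -/

lemma oneSub_injective : Function.Injective oneSub := by
  intro a b h
  rcases a with _ | a <;> rcases b with _ | b
  · rfl
  · exact absurd h (WithBot.bot_ne_coe)
  · exact absurd h (WithBot.coe_ne_bot)
  · have : (1 - (a : ℤ)) = 1 - b := WithBot.coe_injective h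
    have : a = b := by omega
    rw [this]

lemma chi_eq_bot (hS : StepConnected S) (hw : w ∈ S) (h : coreWitnesses m w S = ∅) :
    chi m w = ⊥ ∧ criticalSubgroups m w = ∅ := by
  have hno : ∀ H, ¬ MemK m w H := fun H hH => by
    have := coreSubgroup_mem_coreWitnesses hS hw hH
    simp [h] at this
  constructor
  · have : {n : ℕ∞ | ∃ H : Subgroup (FreeGroup (Fin r)), MemK m w H ∧ freeGroupRank H = n} = ∅ := by
      ext n
      simp [hno]
    rw [chi, this, sInf_empty]
    rfl
  · ext H
    simp [criticalSubgroups, hno]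

lemma exists_chi_eq (hS : StepConnected S) (hfin : S.Finite) (hw : w ∈ S)
    (h : (coreWitnesses m w S).Nonempty) :
    ∃ k : ℕ, chi m w = ((1 - (k : ℤ) : ℤ) : WithBot ℤ) ∧
      (∀ H, MemK m w H → (k : ℕ∞) ≤ freeGroupRank H) ∧
      criticalSubgroups m w = {K | K ∈ coreWitnesses m w S ∧ freeGroupRank K = k} := by
  obtain ⟨K₀, hK₀⟩ := h
  obtain ⟨n₀, hn₀⟩ := exists_freeGroupRank_coreSubgroup hS hfin K₀
  rw [hK₀.1] at hn₀
  set T := {n : ℕ∞ | ∃ H : Subgroup (FreeGroup (Fin r)), MemK m w H ∧ freeGroupRank H = n}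
  have hle : ∀ H, MemK m w H → sInf T ≤ freeGroupRank H := fun H hH => sInf_le ⟨H, hH, rfl⟩
  obtain ⟨k, hk⟩ : ∃ k : ℕ, sInf T = k := by
    have h0 := hle K₀ hK₀.2
    rw [hn₀] at h0
    exact ⟨_, (ENat.natCast_toNat (ne_top_of_le_ne_top (ENat.natCast_ne_top n₀) h0)).symm⟩
  have hchi : chi m w = oneSub k := by rw [chi, hk]
  refine ⟨k, hchi, fun H hH => hk ▸ hle H hH, ?_⟩
  ext H
  constructor
  · rintro ⟨hH, hH'⟩
    rw [hchi] at hH'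
    have hrk : freeGroupRank H = k := (oneSub_injective hH').symm
    have hcore := coreSubgroup_mem_coreWitnesses hS hw hH
    -- The core of `H` is again a witness, so minimality leaves no room for its rank to drop.
    have : coreSubgroup S H = H := coreSubgroup_eq_of_freeGroupRank_eq hS hfin <|
      le_antisymm (freeGroupRank_coreSubgroup_le hS hfin) (by
        rw [hrk, ← hk]
        exact hle _ hcore.2)
    rw [this] at hcore
    exact ⟨hcore, hrk⟩
  · rintro ⟨hH, hrk⟩
    exact ⟨hH.2, by rw [hchi, hrk]⟩

lemma isBigO_zpow_of_le {p q : ℤ} (h : p ≤ q) :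
    (fun N : ℕ => (N : ℂ) ^ p) =O[atTop] fun N : ℕ => (N : ℂ) ^ q := by
  refine IsBigO.of_bound 1 ?_
  filter_upwards [eventually_ge_atTop 1] with N hN
  rw [norm_zpow, norm_zpow, one_mul, Complex.norm_natCast]
  exact zpow_le_zpow_right₀ (by exact_mod_cast hN) h

end Expansion

/-! ### The asymptotic expansion -/

theorem theorem1p8 (r : ℕ) (w : FreeGroup (Fin r)) (m : ℕ∞) (hm : 2 ≤ m) :
    (criticalSubgroups m w).Finite ∧
    ((fun N : ℕ => expectedTrace w m N
        - ((criticalSubgroups m w).ncard : ℂ) * powBot N (chi m w))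
      =O[atTop] fun N : ℕ => powBot N (chi m w + ((-1 : ℤ) : WithBot ℤ))) ∧
    (chi m w = ⊥ → ∀ N : ℕ, expectedTrace w m N = 0) := by
  classical
  obtain ⟨S, hS, hfin, hw⟩ : ∃ S : Set (FreeGroup (Fin r)), StepConnected S ∧ S.Finite ∧ w ∈ S :=
    ⟨suffixSet w.toWord, stepConnected_suffixSet _, finite_suffixSet _, by
      have := mk_mem_suffixSet w.toWord
      rwa [FreeGroup.mk_toWord] at this⟩
  have hE := expectedTrace_eq_sum hm hS hfin hw
  rcases (coreWitnesses m w S).eq_empty_or_nonempty with h | h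
  · obtain ⟨hchi, hcrit⟩ := chi_eq_bot hS hw h
    have hE0 : ∀ N, expectedTrace w m N = 0 := fun N => by simp [hE N, h]
    refine ⟨by simp [hcrit], ?_, fun _ => hE0⟩
    simp only [hE0, hcrit, Set.ncard_empty, Nat.cast_zero, zero_mul, sub_zero]
    exact isBigO_zero _ _
  · obtain ⟨k, hchi, hmin, hcrit⟩ := exists_chi_eq hS hfin hw h
    have hfinW := finite_coreWitnesses (m := m) (w := w) hfin
    refine ⟨?_, ?_, fun hbot => absurd (hchi.symm.trans hbot) WithBot.coe_ne_bot⟩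
    · rw [hcrit]
      exact hfinW.subset fun K hK => hK.1
    · have hcard : (criticalSubgroups m w).ncard =
          (hfinW.toFinset.filter fun K : Subgroup (FreeGroup (Fin r)) => freeGroupRank K = k).card := by
        rw [hcrit, ← Set.ncard_coe_finset]
        refine congrArg Set.ncard (Set.ext fun K => ?_)
        simp
      have hrhs : (fun N : ℕ => powBot N (chi m w + ((-1 : ℤ) : WithBot ℤ))) =
          fun N : ℕ => (N : ℂ) ^ (1 - (k : ℤ) + -1) := by
        rw [hchi, ← WithBot.coe_add]
        rfl
      rw [hrhs]
      have hlhs : (fun N : ℕ => expectedTrace w m N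
          - ((criticalSubgroups m w).ncard : ℂ) * powBot N (chi m w)) =
          fun N : ℕ => ∑ K ∈ hfinW.toFinset, ((coreCount S K N : ℂ) / (N.factorial : ℂ) ^ r -
            if freeGroupRank K = k then (N : ℂ) ^ (1 - (k : ℤ)) else 0) := by
        ext N
        rw [Finset.sum_sub_distrib, ← Finset.sum_filter, Finset.sum_const, ← hcard, hE N, hchi,
          nsmul_eq_mul]
        rfl
      rw [hlhs]
      refine IsBigO.fun_sum fun K hK => ?_
      have hK : K ∈ coreWitnesses m w S := (Set.Finite.mem_toFinset _).1 hK
      obtain ⟨n, hn⟩ := exists_freeGroupRank_coreSubgroup hS hfin K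
      rw [hK.1] at hn
      have hO := isBigO_coreCount hS hfin hK.1 hn
      -- Cores of minimal rank give the main term; for `n > k` even the leading term `N^(1 - n)` is
      -- `O(N^(-k))`.
      by_cases hnk : n = k
      · subst hnk
        simpa only [hn, if_true] using hO
      · have hkn : k ≤ n := by
          have := hmin K hK.2
          rw [hn] at this
          exact_mod_cast this
        have hne : freeGroupRank K ≠ k := by
          rw [hn]
          exact_mod_cast hnk
        simp only [if_neg hne, sub_zero]
        refine ((hO.trans (isBigO_zpow_of_le ?_)).add (isBigO_zpow_of_le ?_)).congr_left
          fun N => sub_add_cancel _ ((N : ℂ) ^ (1 - (n : ℤ)))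
        · omega
        · omega
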